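/- Let $\Omega\subset\mathbb R^d$ ($d\ge 1$) be a bounded open set, let $(\cdot,\cdot)$ and $\|\cdot\|$ be the inner product and norm of $L^2(\Omega)$, let $\varepsilon,L,T>0$, $S\ge 0$, let $f:\mathbb R\to\mathbb R$ be differentiable with $|f'(y)-S|\le L$ for all $y$ (for $S=0$: $|f'|\le L$), let $N\ge 1$, $M\ge 0$, $K\ge1$ be integers, $\tau=T/K$, $t_n=n\tau$, $I_n=[t_{n-1},t_n]$ and $\|w\|_n^2=\int_{I_n}\|w(t)\|^2dt$. Let $P_M^0$ be the space of polynomials of degree $\le M$ on $\Omega$ that vanish on $\partial\Omega$, regarded as a subspace of $H^1_0(\Omega)$, and $V_{M,N}=P_M^0\otimes P_N$ the polynomials of degree $\le N$ in time with coefficients in $P_M^0$. Let $u\in C^{N+1}([0,T];H_0^1(\Omega))$ be a weak solution of the Allen--Cahn equation $u_t-\varepsilon\Delta u+\frac1\varepsilon f(u)=0$, i.e. for $1\le n\le K$, $$\int_{I_n}(u_t,v_t)+\varepsilon(\nabla u,\nabla v_t)+\tfrac1\varepsilon(f(u),v_t)\,dt=0\quad\text{for all } v\in H^1(I_n;H^1_0(\Omega))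 \text{ with } v(t_{n-1})=u(t_{n-1}).$$ Let $h^1\in V_{M,N}$ be arbitrary, and for $2\le n\le K$ let $h^n\in V_{M,N}$ be a solution of the semi-implicit linear scheme on $I_n$: $h^n(t_{n-1})=h^{n-1}(t_{n-1})$ and $$\int_{I_n}(h^n_t,v_t)+\varepsilon(\nabla h^n,\nabla v_t)+\tfrac S\varepsilon(h^n,v_t)+\tfrac1\varepsilon(f(\hat h^n)-S\hat h^n,v_t)\,dt=0\quad\text{for all } v\in V_{M,N}\text{ with }v(t_{n-1})=h^{n-1}(t_{n-1}),$$ where $\hat h^n$ is the extension to $I_n$ of the polynomial $h^{n-1}$. Let $\Pi_M^0:H_0^1(\Omega)\to P_M^0$ be the orthogonal projection with respect to $(\nabla\cdot,\nabla\cdot)$. Let $\Pi_N^n u=\mathcal I_1^nu+\Pi_N^{0,n}(u-\mathcal I^n_1u)$, where $\mathcal I_1^n$ is linear interpolation in time at $t_{n-1},t_n$ and $\Pi_N^{0,n}$ is the projection, orthogonal for $\int_{I_n}v'w'\,dt$, on the polynomials in $t$ of degree $\le N$ that vanish at $t_{n-1}$ and $t_n$. Let $\mathcal T_N^n$ denote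 the Taylor polynomial in time of degree $N$ at $t_{n-1}$. Put $$\Pi^n=\Pi^n_N\Pi^0_M,\quad \hat\Pi^n=\mathcal T^n_N\Pi^0_M,\quad \rho^n=h^n-\Pi^nu,\quad \pi^n=\Pi^nu-u,\quad \hat\pi^n=\hat\Pi^nu-u,$$ $$\pi_M^n=(\Pi_M^0-I)\Pi_N^nu,\qquad \pi_N^n=(\Pi_N^n-I)\Pi_M^0u .$$ Let $L_k$ be the Legendre polynomials, $c_k=\int_1^3L_k^2\,dx\big/\int_{-1}^1L_k^2\,dx$, $C_{N-1}=\big(\sum_{k=0}^{N-1}c_k\big)^{1/2}$, and $$D_\tau=\tfrac{\varepsilon}{L}\Big(\tfrac14-\tfrac{4\tau^2L^2(1+6C_{N-1}^2)}{\varepsilon^2}\Big),\quad D_2=\tfrac{8L}{\varepsilon},\quad D_3=\tfrac{24L\tau C_{N-1}^2}{\varepsilon},$$ $$\hat E_p^k=\tfrac{\varepsilon}{L}\Big[6\|\partial_t\pi_M^k+\tfrac S\varepsilon\pi^k\|_k^2+6\varepsilon^2\|\nabla^2\pi_N^k\|_k^2+\tfrac{4L^2\tau}{\varepsilon^2}\|\pi^k(t_{k-1})\|^2+\tfrac{12L^2\tau^2C_{N-1}^2}{\varepsilon^2}\big(\|\hat\pi^k_t\|_k^2+2\|\partial_t(\hat\Pi^ku-\Pi^{k-1}u)\|_{k-1}^2\big)\Big],$$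 where $\nabla^2$ is the Laplacian. If $\tau\le\dfrac{\varepsilon}{4L\sqrt{6C_{N-1}^2+1}}$, then for all $2\le n\le K$ $$\Big(1+\tfrac{S}{2L}\Big)\|\rho^n(t_n)\|^2+\tfrac{\varepsilon^2}{2L}\|\nabla\rho^n(t_n)\|^2+\sum_{k=1}^nD_\tau\|\rho^k_t\|_k^2+D_3\tau\|\rho^n_t\|_n^2$$ $$\le\sum_{k=2}^ne^{D_2(n-k)\tau}\hat E_p^k+e^{D_2(n-1)\tau}\Big(\big(1+\tfrac{S}{2L}\big)\|\rho^1(t_1)\|^2+\tfrac{\varepsilon^2}{2L}\|\nabla\rho^1(t_1)\|^2+D_3\tau\|\rho_t^1\|_1^2\Big)+D_\tau\|\rho^1_t\|_1^2 .$$ -/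

import Mathlib

open MeasureTheory Set Polynomial
open scoped ContDiff

noncomputable section

namespace ESET

/-! ### The spaces `L²(Ω)` and `H¹₀(Ω)` -/

/-- `L²(Ω)`. -/
abbrev L2 {d : ℕ} (Ω : Set (EuclideanSpace ℝ (Fin d))) : Type :=
  Lp ℝ 2 (volume.restrict Ω)

/-- `L²(Ω; ℝ^d)`. -/
abbrev L2Vec {d : ℕ} (Ω : Set (EuclideanSpace ℝ (Fin d))) : Type :=
  Lp (EuclideanSpace ℝ (Fin d)) 2 (volume.restrict Ω)

/-- The Hilbert space `L²(Ω) × L²(Ω; ℝ^d)`, in which a function is recorded with its gradient. -/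
abbrev L2Pair {d : ℕ} (Ω : Set (EuclideanSpace ℝ (Fin d))) : Type :=
  WithLp 2 (L2 Ω × L2Vec Ω)

/-- The pairs `(φ, ∇φ)` with `φ` smooth and compactly supported in `Ω`. -/
def testPairs {d : ℕ} (Ω : Set (EuclideanSpace ℝ (Fin d))) : Set (L2Pair Ω) :=
  {z | ∃ φ : EuclideanSpace ℝ (Fin d) → ℝ,
    ContDiff ℝ ∞ φ ∧ HasCompactSupport φ ∧ tsupport φ ⊆ Ω ∧
    (z.fst : EuclideanSpace ℝ (Fin d) → ℝ) =ᵐ[volume.restrict Ω] φ ∧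
    (z.snd : EuclideanSpace ℝ (Fin d) → EuclideanSpace ℝ (Fin d))
      =ᵐ[volume.restrict Ω] gradient φ}

/-- `H¹₀(Ω)`: the closure of the test functions in the norm
`(‖w‖² + ‖∇w‖²)^{1/2}`; an element is the pair of a function and its weak gradient. -/
def h01Submodule {d : ℕ} (Ω : Set (EuclideanSpace ℝ (Fin d))) : Submodule ℝ (L2Pair Ω) :=
  (Submodule.span ℝ (testPairs Ω)).topologicalClosure

/-- `H¹₀(Ω)` as a Hilbert space, with its `H¹` norm. -/
abbrev H01 {d : ℕ} (Ω : Set (EuclideanSpace ℝ (Fin d))) : Type := h01Submodule Ω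

/-- The element `w ∈ H¹₀(Ω)` as an element of `L²(Ω)`. -/
def toL2 {d : ℕ} {Ω : Set (EuclideanSpace ℝ (Fin d))} (w : H01 Ω) : L2 Ω :=
  (w : L2Pair Ω).fst

/-- The weak gradient of `w ∈ H¹₀(Ω)`. -/
def grad {d : ℕ} {Ω : Set (EuclideanSpace ℝ (Fin d))} (w : H01 Ω) : L2Vec Ω :=
  (w : L2Pair Ω).snd

/-- The pairing `(g(w), v) = ∫_Ω g(w(x)) v(x) dx`. -/
def nonlinPair {d : ℕ} {Ω : Set (EuclideanSpace ℝ (Fin d))} (g : ℝ → ℝ) (w v : H01 Ω) : ℝ :=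
  ∫ x in Ω, g (toL2 w x) * toL2 v x

/-- `g ∈ L²(Ω)` is the (weak) Laplacian of `w ∈ H¹₀(Ω)`. -/
def IsLaplacian {d : ℕ} {Ω : Set (EuclideanSpace ℝ (Fin d))} (w : H01 Ω) (g : L2 Ω) : Prop :=
  ∀ φ : H01 Ω, inner ℝ g (toL2 φ) = - inner ℝ (grad w) (grad φ)

/-- The Laplacian `∇²w ∈ L²(Ω)`; it is used only for polynomials `w`, for which it exists,
and it is unique. -/
def laplacian {d : ℕ} {Ω : Set (EuclideanSpace ℝ (Fin d))} (w : H01 Ω) : L2 Ω :=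
  Classical.epsilon (IsLaplacian w)

/-! ### Polynomials in space and time, and the projections -/

/-- `P_M^0(Ω)`: the polynomials of (total) degree at most `M` that vanish on the boundary,
as elements of `H¹₀(Ω)`. -/
def polySpace {d : ℕ} (Ω : Set (EuclideanSpace ℝ (Fin d))) (M : ℕ) : Set (H01 Ω) :=
  {w | ∃ p : MvPolynomial (Fin d) ℝ, p.totalDegree ≤ M ∧
    (∀ x ∈ frontier Ω, MvPolynomial.eval (fun i => x i) p = 0) ∧
    (toL2 w : EuclideanSpace ℝ (Fin d) → ℝ) =ᵐ[volume.restrict Ω]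
      fun x => MvPolynomial.eval (fun i => x i) p}

/-- The polynomials of degree at most `N` in time with coefficients in a set `Y` of a real
vector space, as functions on the whole real line (so that each is its own extension from
any interval). -/
def timePoly {X : Type*} [AddCommGroup X] [Module ℝ X] (N : ℕ) (Y : Set X) : Set (ℝ → X) :=
  {p | ∃ c : ℕ → X, (∀ i, c i ∈ Y) ∧ ∀ t, p t = ∑ i ∈ Finset.range (N + 1), t ^ i • c i}

/-- The discrete space `V_{M,N} = P_M^0(Ω) ⊗ P_N`. -/
def discreteSpace {d : ℕ} (Ω : Set (EuclideanSpace ℝ (Fin d))) (M N : ℕ) : Set (ℝ → H01 Ω) :=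
  timePoly N (polySpace Ω M)

/-- `p` is the elliptic projection of `w` on `P_M^0(Ω)`. -/
def IsSpaceProj {d : ℕ} {Ω : Set (EuclideanSpace ℝ (Fin d))} (M : ℕ) (w p : H01 Ω) : Prop :=
  p ∈ polySpace Ω M ∧ ∀ q ∈ polySpace Ω M, inner ℝ (grad (p - w)) (grad q) = 0

/-- The elliptic projection `Π_M^0 : H¹₀(Ω) → P_M^0(Ω)`; for bounded `Ω` it exists and is unique. -/
def spaceProj {d : ℕ} {Ω : Set (EuclideanSpace ℝ (Fin d))} (M : ℕ) (w : H01 Ω) : H01 Ω :=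
  Classical.epsilon (IsSpaceProj M w)

/-- Linear interpolation in time at the end points of `[a, b]`. -/
def interp {X : Type*} [AddCommGroup X] [Module ℝ X] (a b : ℝ) (u : ℝ → X) (t : ℝ) : X :=
  ((b - t) / (b - a)) • u a + ((t - a) / (b - a)) • u b

/-- `p` is the `H¹₀(a,b)`-projection of `u` (with `u(a) = u(b) = 0`) on the polynomials of
degree at most `N` that vanish at `a` and `b`; functions of time have values in `X`. -/
def IsTimeProjZero {X : Type*} [NormedAddCommGroup X] [NormedSpace ℝ X]
    (N : ℕ) (a b : ℝ) (u p : ℝ → X) : Prop :=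
  p ∈ timePoly N (Set.univ : Set X) ∧ p a = 0 ∧ p b = 0 ∧
  ∀ v : ℝ[X], v.natDegree ≤ N → v.eval a = 0 → v.eval b = 0 →
    ∫ t in a..b, v.derivative.eval t • (deriv u t - deriv p t) = 0

/-- The projection `Π_N^{0}` on `P_N^0([a,b])`; for `a < b` and `u` continuously differentiable
(or in `H¹`) it exists and is unique. -/
def timeProjZero {X : Type*} [NormedAddCommGroup X] [NormedSpace ℝ X]
    (N : ℕ) (a b : ℝ) (u : ℝ → X) : ℝ → X :=
  Classical.epsilon (IsTimeProjZero N a b u)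

/-- The projection `Π_N u = I_1 u + Π_N^0 (u - I_1 u)` in time on the interval `[a,b]`. -/
def timeProj {X : Type*} [NormedAddCommGroup X] [NormedSpace ℝ X]
    (N : ℕ) (a b : ℝ) (u : ℝ → X) : ℝ → X :=
  interp a b u + timeProjZero N a b (u - interp a b u)

/-! ### The exact problem and the scheme -/

/-- `v ∈ H¹(a,b;X)` with time derivative `v' ∈ L²(a,b;X)`. -/
def HasTimeDeriv {X : Type*} [NormedAddCommGroup X] [NormedSpace ℝ X]
    (a b : ℝ) (v v' : ℝ → X) : Prop :=
  MemLp v' 2 (volume.restrict (Icc a b)) ∧ ∀ t ∈ Icc a b, v t = v a + ∫ s in a..t, v' s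

/-- `u ∈ H¹(a,b;H¹₀(Ω))` is a solution of the energetic weak form on `[a,b]`:
`∫_a^b (u_t, v_t) + ε (∇u, ∇v_t) + (1/ε) (f(u), v_t) dt = 0`
for all `v ∈ H¹(a,b;H¹₀(Ω))` with `v(a) = u(a)`. -/
def IsWeakSolution {d : ℕ} {Ω : Set (EuclideanSpace ℝ (Fin d))} (f : ℝ → ℝ) (ε a b : ℝ)
    (u : ℝ → H01 Ω) : Prop :=
  ∃ u' : ℝ → H01 Ω, HasTimeDeriv a b u u' ∧
    ∀ v v' : ℝ → H01 Ω, HasTimeDeriv a b v v' → v a = u a →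
      ∫ t in a..b, (inner ℝ (toL2 (u' t)) (toL2 (v' t))
        + ε * inner ℝ (grad (u t)) (grad (v' t))
        + 1 / ε * nonlinPair f (u t) (v' t)) = 0

/-- `h` is the solution on `[a,b]` of the semi-implicit linear scheme with stabilization
constant `S`, where `g ∈ V_{M,N}` is the numerical solution on the preceding interval, which
ends at `a`: `h ∈ V_{M,N}`, `h(a) = g(a)` and
`∫_a^b (h_t, v_t) + ε (∇h, ∇v_t) + (S/ε) (h, v_t) + (1/ε) (f(g) - S g, v_t) dt = 0`
for all `v ∈ V_{M,N}` with `v(a) = g(a)`. The polynomial `g` is extended to `[a,b]`. -/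
def IsSemiImplicitStep {d : ℕ} {Ω : Set (EuclideanSpace ℝ (Fin d))} (f : ℝ → ℝ) (ε S : ℝ)
    (M N : ℕ) (a b : ℝ) (g h : ℝ → H01 Ω) : Prop :=
  h ∈ discreteSpace Ω M N ∧ h a = g a ∧
    ∀ v ∈ discreteSpace Ω M N, v a = g a →
      ∫ t in a..b, (inner ℝ (toL2 (deriv h t)) (toL2 (deriv v t))
        + ε * inner ℝ (grad (h t)) (grad (deriv v t))
        + S / ε * inner ℝ (toL2 (h t)) (toL2 (deriv v t))
        + 1 / ε * nonlinPair (fun y => f y - S * y) (g t) (deriv v t)) = 0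

/-! ### The Legendre extrapolation constant -/

/-- The Legendre polynomial `L_k` (Rodrigues' formula). -/
def legendre (k : ℕ) : ℝ[X] :=
  C (1 / (2 ^ k * (k.factorial : ℝ))) * derivative^[k] ((X ^ 2 - 1) ^ k)

/-- `c_k = ∫_1^3 L_k² / ∫_{-1}^1 L_k²`. -/
def extrapRatio (k : ℕ) : ℝ :=
  (∫ x in (1 : ℝ)..3, (legendre k).eval x ^ 2) / ∫ x in (-1 : ℝ)..1, (legendre k).eval x ^ 2

/-- `C_m = (∑_{k=0}^m c_k)^{1/2}`. -/
def extrapConst (m : ℕ) : ℝ := √(∑ k ∈ Finset.range (m + 1), extrapRatio k)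

/-! ### The error and projection quantities on the intervals `I_n = [(n-1)τ, nτ]` -/

/-- The node `t_n = n τ`. -/
def node (τ : ℝ) (n : ℕ) : ℝ := n * τ

/-- `‖w‖_n² = ∫_{I_n} ‖w(t)‖² dt`, for `n ≥ 1`. -/
def slabNormSq {d : ℕ} {Ω : Set (EuclideanSpace ℝ (Fin d))} (τ : ℝ) (n : ℕ)
    (w : ℝ → L2 Ω) : ℝ :=
  ∫ t in node τ (n - 1)..node τ n, ‖w t‖ ^ 2

/-- `Π^n u = Π_N^n Π_M^0 u`. -/
def fullProj {d : ℕ} {Ω : Set (EuclideanSpace ℝ (Fin d))} (M N : ℕ) (τ : ℝ) (n : ℕ)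
    (u : ℝ → H01 Ω) : ℝ → H01 Ω :=
  timeProj N (node τ (n - 1)) (node τ n) (fun t => spaceProj M (u t))

/-- `π^n = Π^n u - u`. -/
def projErr {d : ℕ} {Ω : Set (EuclideanSpace ℝ (Fin d))} (M N : ℕ) (τ : ℝ) (n : ℕ)
    (u : ℝ → H01 Ω) (t : ℝ) : H01 Ω :=
  fullProj M N τ n u t - u t

/-- `π_M^n = (Π_M^0 - I) Π_N^n u`. -/
def projErrSpace {d : ℕ} {Ω : Set (EuclideanSpace ℝ (Fin d))} (M N : ℕ) (τ : ℝ) (n : ℕ)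
    (u : ℝ → H01 Ω) (t : ℝ) : H01 Ω :=
  spaceProj M (timeProj N (node τ (n - 1)) (node τ n) u t)
    - timeProj N (node τ (n - 1)) (node τ n) u t

/-- `π_N^n = (Π_N^n - I) Π_M^0 u`. -/
def projErrTime {d : ℕ} {Ω : Set (EuclideanSpace ℝ (Fin d))} (M N : ℕ) (τ : ℝ) (n : ℕ)
    (u : ℝ → H01 Ω) (t : ℝ) : H01 Ω :=
  fullProj M N τ n u t - spaceProj M (u t)

/-- `Π̂^n u = T_N^n Π_M^0 u`: the Taylor polynomial in time of degree `N` of `Π_M^0 u`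
at `t_{n-1}`, for `u` given on the time interval `[0,T]`. -/
def taylorProj {d : ℕ} {Ω : Set (EuclideanSpace ℝ (Fin d))} (M N : ℕ) (T τ : ℝ) (n : ℕ)
    (u : ℝ → H01 Ω) (t : ℝ) : H01 Ω :=
  taylorWithinEval (fun s => spaceProj M (u s)) N (Icc 0 T) (node τ (n - 1)) t

/-- `π̂^n = Π̂^n u - u`. -/
def taylorErr {d : ℕ} {Ω : Set (EuclideanSpace ℝ (Fin d))} (M N : ℕ) (T τ : ℝ) (n : ℕ)
    (u : ℝ → H01 Ω) (t : ℝ) : H01 Ω :=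
  taylorProj M N T τ n u t - u t

/-- `ρ^n = h^n - Π^n u`. -/
def rho {d : ℕ} {Ω : Set (EuclideanSpace ℝ (Fin d))} (M N : ℕ) (τ : ℝ)
    (u : ℝ → H01 Ω) (h : ℕ → ℝ → H01 Ω) (n : ℕ) (t : ℝ) : H01 Ω :=
  h n t - fullProj M N τ n u t

/-- `D_τ = (ε/L) (1/4 - 4 τ² L² (1 + 6 C_{N-1}²) / ε²)`. -/
def Dtau (ε L τ : ℝ) (N : ℕ) : ℝ :=
  ε / L * (1 / 4 - 4 * τ ^ 2 * L ^ 2 * (1 + 6 * extrapConst (N - 1) ^ 2) / ε ^ 2)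

/-- `D_2 = 8 L / ε`. -/
def D2 (ε L : ℝ) : ℝ := 8 * L / ε

/-- `D_3 = 24 L τ C_{N-1}² / ε`. -/
def D3 (ε L τ : ℝ) (N : ℕ) : ℝ := 24 * L * τ * extrapConst (N - 1) ^ 2 / ε

/-- The projection quantity `Ê_p^k`, for `k ≥ 2`. -/
def Ehat {d : ℕ} {Ω : Set (EuclideanSpace ℝ (Fin d))} (ε L S : ℝ) (M N : ℕ) (T τ : ℝ)
    (u : ℝ → H01 Ω) (k : ℕ) : ℝ :=
  ε / L *
    (6 * slabNormSq τ k (fun t => toL2 (deriv (projErrSpace M N τ k u) t)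
        + (S / ε) • toL2 (projErr M N τ k u t))
      + 6 * ε ^ 2 * slabNormSq τ k (fun t => laplacian (projErrTime M N τ k u t))
      + 4 * L ^ 2 * τ / ε ^ 2 * ‖toL2 (projErr M N τ k u (node τ (k - 1)))‖ ^ 2
      + 12 * L ^ 2 * τ ^ 2 * extrapConst (N - 1) ^ 2 / ε ^ 2 *
        (slabNormSq τ k (fun t => toL2 (deriv (taylorErr M N T τ k u) t))
          + 2 * slabNormSq τ (k - 1)
              (fun t => toL2 (deriv (fun s => taylorProj M N T τ k u s
                - fullProj M N τ (k - 1) u s) t))))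

end ESET

end

open ESET

/-!
Both equations are tested with `ρ^n_t`. The elliptic projection annihilates `(∇π_M^n, ∇ρ^n_t)`, the
time projection annihilates `(∂_t π_N^n, ρ^n_t)`, and `(∇π_N^n, ∇ρ^n_t) = -(∇²π_N^n, ρ^n_t)`, so the
linear part leaves only the first two terms of `Ê_p^n`.

In the nonlinear part `f - S·` is `L`-Lipschitz, so one must bound `ĥ^n - u` on `I_n`: its value at
`t_{n-1}` is `ρ^n + π^n`, and its time derivative is compared with that of the Taylor polynomial of
`u`. The difference `∂_t (ĥ^n - Π̂^n u)` is a polynomial of degree `N - 1` in time, whose `L²` norm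
on `I_n` is at most `C_{N-1}` times its `L²` norm on `I_{n-1}`, as one sees by expanding it in
Legendre polynomials; there it is split through `Π^{n-1} u` into `ρ^{n-1}_t` and a projection error.

Young's inequality and `‖ρ(t_n)‖² ≤ (1 + θ) ‖ρ(t_{n-1})‖² + (1 + 1/θ) τ ‖ρ_t‖_n²` turn this into a
recursion from `I_{n-1}` to `I_n` with growth factor `1 + D_2 τ ≤ exp (D_2 τ)`; the bound on `τ`
makes `D_τ` nonnegative, and the discrete Gronwall inequality concludes.
-/

namespace ESET

/-! ### Legendre polynomials -/

theorem integral_derivative_mul (p q : ℝ[X]) (a b : ℝ) :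
    ∫ x in a..b, (derivative p).eval x * q.eval x =
      p.eval b * q.eval b - p.eval a * q.eval a
        - ∫ x in a..b, p.eval x * (derivative q).eval x := by
  rw [intervalIntegral.integral_mul_deriv_eq_deriv_mul
    (fun x _ => p.hasDerivAt x) (fun x _ => q.hasDerivAt x)
    ((derivative p).continuous.intervalIntegrable _ _)
    ((derivative q).continuous.intervalIntegrable _ _)]
  ring

theorem integral_eval_sq_pos {p : ℝ[X]} (hp : p ≠ 0) {a b : ℝ} (hab : a < b) :
    0 < ∫ x in a..b, p.eval x ^ 2 := by
  obtain ⟨c, hc, hpc⟩ : ∃ c ∈ Icc a b, p.eval c ≠ 0 := by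
    by_contra! hroot
    exact hp (p.eq_zero_of_infinite_isRoot ((Icc_infinite hab).mono hroot))
  exact intervalIntegral.integral_pos hab (by fun_prop) (fun x _ => sq_nonneg _)
    ⟨c, hc, by positivity⟩

theorem integral_iterate_derivative_mul_eq_zero {k m : ℕ} (hm : m ≤ k) {q : ℝ[X]}
    (hq : derivative^[m] q = 0) :
    ∫ x in (-1 : ℝ)..1, (derivative^[m] ((X ^ 2 - 1 : ℝ[X]) ^ k)).eval x * q.eval x = 0 := by
  induction m generalizing q with
  | zero =>
    simp only [Function.iterate_zero, id] at hq
    simp [hq]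
  | succ m ih =>
    have hroot (x : ℝ) (hx : x ^ 2 - 1 = 0) :
        (derivative^[m] ((X ^ 2 - 1 : ℝ[X]) ^ k)).eval x = 0 := by
      obtain ⟨r, hr⟩ := pow_sub_dvd_iterate_derivative_pow (X ^ 2 - 1 : ℝ[X]) k m
      have : k - m ≠ 0 := by omega
      simp [hr, hx, this]
    simp only [Function.iterate_succ_apply']
    rw [integral_derivative_mul, hroot 1 (by norm_num), hroot (-1) (by norm_num),
      ih (by omega) (by rwa [← Function.iterate_succ_apply])]
    simp

theorem natDegree_legendre (k : ℕ) : (legendre k).natDegree = k := by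
  have hmonic : (X ^ 2 - 1 : ℝ[X]).Monic := by monicity!
  have hdeg : ((X ^ 2 - 1 : ℝ[X]) ^ k).natDegree = k + k := by
    rw [hmonic.natDegree_pow, show (X ^ 2 - 1 : ℝ[X]).natDegree = 2 by compute_degree!]
    ring
  refine le_antisymm ?_ (le_natDegree_of_ne_zero ?_)
  · refine (natDegree_C_mul_le _ _).trans ((natDegree_iterate_derivative _ _).trans ?_)
    omega
  · have hcoeff : ((X ^ 2 - 1 : ℝ[X]) ^ k).coeff (k + k) = 1 := by
      rw [← hdeg]
      exact (hmonic.pow k).coeff_natDegree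
    have hfact : (k + k).descFactorial k ≠ 0 := by
      rw [Ne, Nat.descFactorial_eq_zero_iff_lt]
      omega
    rw [legendre, coeff_C_mul, coeff_iterate_derivative, hcoeff, nsmul_one]
    positivity

theorem legendre_ne_zero (k : ℕ) : legendre k ≠ 0 := by
  rcases k.eq_zero_or_pos with rfl | hk
  · simp [legendre]
  · exact ne_zero_of_natDegree_gt (n := 0) (by rwa [natDegree_legendre])

theorem integral_legendre_mul_eq_zero {k : ℕ} {q : ℝ[X]} (hq : q.natDegree < k) :
    ∫ x in (-1 : ℝ)..1, (legendre k).eval x * q.eval x = 0 := by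
  simp only [legendre, eval_mul, eval_C, mul_assoc, intervalIntegral.integral_const_mul,
    integral_iterate_derivative_mul_eq_zero le_rfl (iterate_derivative_eq_zero hq), mul_zero]

theorem integral_legendre_mul_legendre {j k : ℕ} (hjk : j ≠ k) :
    ∫ x in (-1 : ℝ)..1, (legendre j).eval x * (legendre k).eval x = 0 := by
  rcases lt_or_gt_of_ne hjk with h | h
  · simp only [mul_comm ((legendre j).eval _)]
    exact integral_legendre_mul_eq_zero (by rwa [natDegree_legendre])
  · exact integral_legendre_mul_eq_zero (by rwa [natDegree_legendre])

theorem extrapRatio_nonneg (k : ℕ) : 0 ≤ extrapRatio k :=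
  div_nonneg (intervalIntegral.integral_nonneg (by norm_num) fun _ _ => sq_nonneg _)
    (intervalIntegral.integral_nonneg (by norm_num) fun _ _ => sq_nonneg _)

theorem extrapRatio_zero : extrapRatio 0 = 1 := by
  norm_num [extrapRatio, legendre]

theorem extrapConst_sq (m : ℕ) :
    extrapConst m ^ 2 = ∑ k ∈ Finset.range (m + 1), extrapRatio k :=
  Real.sq_sqrt (Finset.sum_nonneg fun k _ => extrapRatio_nonneg k)

theorem one_le_extrapConst_sq (m : ℕ) : 1 ≤ extrapConst m ^ 2 := by
  rw [extrapConst_sq, ← extrapRatio_zero]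
  exact Finset.single_le_sum (fun k _ => extrapRatio_nonneg k) (Finset.mem_range.2 m.succ_pos)

/-- The Legendre polynomial transported affinely from `[-1, 1]` to `[a, b]`. -/
noncomputable def scaledLegendre (a b : ℝ) (k : ℕ) : ℝ[X] :=
  (legendre k).comp (C (2 / (b - a)) * X - C ((a + b) / (b - a)))

section ScaledLegendre

variable {a b : ℝ}

theorem eval_scaledLegendre (a b : ℝ) (k : ℕ) (t : ℝ) :
    (scaledLegendre a b k).eval t = (legendre k).eval (2 / (b - a) * t - (a + b) / (b - a)) := by
  simp [scaledLegendre]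

theorem natDegree_scaledLegendre (hab : a < b) (k : ℕ) : (scaledLegendre a b k).natDegree = k := by
  have hne : 2 / (b - a) ≠ 0 := div_ne_zero two_ne_zero (sub_pos.2 hab).ne'
  rw [scaledLegendre, natDegree_comp, natDegree_legendre, natDegree_sub_C, natDegree_C_mul_X _ hne,
    mul_one]

theorem scaledLegendre_ne_zero (hab : a < b) (k : ℕ) : scaledLegendre a b k ≠ 0 := by
  have hne : 2 / (b - a) ≠ 0 := div_ne_zero two_ne_zero (sub_pos.2 hab).ne'
  rw [scaledLegendre, Ne, comp_eq_zero_iff, not_or, not_and]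
  refine ⟨legendre_ne_zero k, fun _ h => ?_⟩
  have := congrArg natDegree h
  rw [natDegree_sub_C, natDegree_C_mul_X _ hne, natDegree_C] at this
  exact one_ne_zero this

theorem integral_scaledLegendre_sq_pos (hab : a < b) (k : ℕ) :
    0 < ∫ t in a..b, (scaledLegendre a b k).eval t ^ 2 :=
  integral_eval_sq_pos (scaledLegendre_ne_zero hab k) hab

theorem integral_comp_affine (hab : a < b) (c e : ℝ) (F : ℝ → ℝ) :
    ∫ t in c..e, F (2 / (b - a) * t - (a + b) / (b - a)) =
      (b - a) / 2 * ∫ x in (2 * c - (a + b)) / (b - a)..(2 * e - (a + b)) / (b - a), F x := by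
  rw [intervalIntegral.integral_comp_mul_sub F
    (div_ne_zero two_ne_zero (sub_ne_zero.2 hab.ne')), smul_eq_mul, inv_div]
  ring_nf

theorem integral_scaledLegendre_mul (hab : a < b) {j k : ℕ} (hjk : j ≠ k) :
    ∫ t in a..b, (scaledLegendre a b j).eval t * (scaledLegendre a b k).eval t = 0 := by
  have h : b - a ≠ 0 := (sub_pos.2 hab).ne'
  simp only [eval_scaledLegendre]
  rw [integral_comp_affine hab a b (fun x => (legendre j).eval x * (legendre k).eval x),
    show (2 * a - (a + b)) / (b - a) = -1 by field_simp; ring,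
    show (2 * b - (a + b)) / (b - a) = 1 by field_simp; ring,
    integral_legendre_mul_legendre hjk, mul_zero]

theorem integral_scaledLegendre_sq_next (hab : a < b) (k : ℕ) :
    ∫ t in b..(2 * b - a), (scaledLegendre a b k).eval t ^ 2 =
      extrapRatio k * ∫ t in a..b, (scaledLegendre a b k).eval t ^ 2 := by
  have h : b - a ≠ 0 := (sub_pos.2 hab).ne'
  have hpos := integral_eval_sq_pos (legendre_ne_zero k) (show (-1 : ℝ) < 1 by norm_num)
  simp only [eval_scaledLegendre]
  rw [integral_comp_affine hab b (2 * b - a) (fun x => (legendre k).eval x ^ 2),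
    integral_comp_affine hab a b (fun x => (legendre k).eval x ^ 2),
    show (2 * a - (a + b)) / (b - a) = -1 by field_simp; ring,
    show (2 * b - (a + b)) / (b - a) = 1 by field_simp; ring,
    show (2 * (2 * b - a) - (a + b)) / (b - a) = 3 by field_simp; ring, extrapRatio]
  field_simp

theorem exists_eval_eq_sum_scaledLegendre (hab : a < b) {m : ℕ} {q : ℝ[X]}
    (hq : q.natDegree ≤ m) :
    ∃ c : ℕ → ℝ, ∀ t,
      q.eval t = ∑ k ∈ Finset.range (m + 1), c k * (scaledLegendre a b k).eval t := by
  let P : Polynomial.Sequence ℝ := ⟨scaledLegendre a b, fun k => by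
    rw [degree_eq_natDegree (scaledLegendre_ne_zero hab k), natDegree_scaledLegendre hab]⟩
  have hspan := P.span_degreeLT (m := m + 1) fun k _ =>
    (leadingCoeff_ne_zero.2 (P.ne_zero k)).isUnit
  have hmem : q ∈ Submodule.span ℝ (P '' Finset.range (m + 1)) := by
    rw [Finset.coe_range, hspan, mem_degreeLT]
    exact degree_le_natDegree.trans_lt (by exact_mod_cast Nat.lt_succ_of_le hq)
  obtain ⟨c, hc⟩ := (Submodule.mem_span_image_finset_iff_exists_fun' ℝ).1 hmem
  refine ⟨c, fun t => ?_⟩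
  rw [← hc, eval_finsetSum]
  simp only [eval_smul, smul_eq_mul]
  rfl

end ScaledLegendre

/-! ### Polynomials in time with values in a vector space -/

section TimePoly

variable {V : Type*} [NormedAddCommGroup V] [NormedSpace ℝ V]

/-- The polynomials of degree at most `n` in time with coefficients in a subspace `Y`, as a
subspace of the functions of time; its carrier is `timePoly n Y`. -/
def timePolySubmodule (n : ℕ) (Y : Submodule ℝ V) : Submodule ℝ (ℝ → V) where
  carrier := timePoly n (Y : Set V)
  zero_mem' := ⟨0, fun _ => Y.zero_mem, fun t => by simp⟩
  add_mem' := by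
    rintro p q ⟨c, hc, hp⟩ ⟨e, he, hq⟩
    exact ⟨c + e, fun i => Y.add_mem (hc i) (he i), fun t => by
      simp [hp, hq, Finset.sum_add_distrib]⟩
  smul_mem' := by
    rintro r p ⟨c, hc, hp⟩
    exact ⟨r • c, fun i => Y.smul_mem r (hc i), fun t => by
      simp [hp, Finset.smul_sum, smul_comm r]⟩

theorem add_mem_timePoly {Y : Submodule ℝ V} {n : ℕ} {p q : ℝ → V}
    (hp : p ∈ timePoly n (Y : Set V)) (hq : q ∈ timePoly n (Y : Set V)) :
    p + q ∈ timePoly n (Y : Set V) :=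
  (timePolySubmodule n Y).add_mem hp hq

theorem sub_mem_timePoly {Y : Submodule ℝ V} {n : ℕ} {p q : ℝ → V}
    (hp : p ∈ timePoly n (Y : Set V)) (hq : q ∈ timePoly n (Y : Set V)) :
    p - q ∈ timePoly n (Y : Set V) :=
  (timePolySubmodule n Y).sub_mem hp hq

theorem sum_eval_smul_mem_timePoly {Y : Submodule ℝ V} {n : ℕ} {ι : Type*} (s : Finset ι)
    {q : ι → ℝ[X]} (hq : ∀ i ∈ s, (q i).natDegree ≤ n) {x : ι → V} (hx : ∀ i, x i ∈ Y) :
    (fun t => ∑ i ∈ s, (q i).eval t • x i) ∈ timePoly n (Y : Set V) := by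
  refine ⟨fun j => ∑ i ∈ s, (q i).coeff j • x i,
    fun j => Y.sum_mem fun i _ => Y.smul_mem _ (hx i), fun t => ?_⟩
  simp only [Finset.smul_sum, smul_smul]
  rw [Finset.sum_comm]
  refine Finset.sum_congr rfl fun i hi => ?_
  rw [eval_eq_sum_range' (Nat.lt_succ_of_le (hq i hi)), Finset.sum_smul]
  simp only [mul_comm]

theorem const_mem_timePoly {Y : Submodule ℝ V} (n : ℕ) {x : V} (hx : x ∈ Y) :
    (fun _ => x) ∈ timePoly n (Y : Set V) := by
  simpa using sum_eval_smul_mem_timePoly {()} (q := fun _ => 1) (n := n) (by simp) fun _ => hx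

theorem timePoly_mono {Y Z : Set V} (h : Y ⊆ Z) {n : ℕ} {p : ℝ → V} (hp : p ∈ timePoly n Y) :
    p ∈ timePoly n Z := by
  obtain ⟨c, hc, hpc⟩ := hp
  exact ⟨c, fun i => h (hc i), hpc⟩

theorem mem_of_mem_timePoly {Y : Submodule ℝ V} {n : ℕ} {p : ℝ → V}
    (hp : p ∈ timePoly n (Y : Set V)) (t : ℝ) : p t ∈ Y := by
  obtain ⟨c, hc, hpc⟩ := hp
  rw [hpc]
  exact Y.sum_mem fun i _ => Y.smul_mem _ (hc i)

theorem map_mem_timePoly {Z : Type*} [AddCommGroup Z] [Module ℝ Z] (A : V →ₗ[ℝ] Z)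
    {Y : Set V} {W : Set Z} (hA : ∀ y ∈ Y, A y ∈ W) {n : ℕ} {p : ℝ → V}
    (hp : p ∈ timePoly n Y) : (fun t => A (p t)) ∈ timePoly n W := by
  obtain ⟨c, hc, hpc⟩ := hp
  exact ⟨fun i => A (c i), fun i => hA _ (hc i), fun t => by simp [hpc]⟩

theorem continuous_of_mem_timePoly {Y : Set V} {n : ℕ} {p : ℝ → V} (hp : p ∈ timePoly n Y) :
    Continuous p := by
  obtain ⟨c, -, hpc⟩ := hp
  rw [funext hpc]
  fun_prop

theorem exists_hasDerivAt_of_mem_timePoly {Y : Submodule ℝ V} {m : ℕ} {p : ℝ → V}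
    (hp : p ∈ timePoly (m + 1) (Y : Set V)) :
    ∃ q ∈ timePoly m (Y : Set V), ∀ t, HasDerivAt p (q t) t := by
  obtain ⟨c, hc, hpc⟩ := hp
  refine ⟨fun t => ∑ i ∈ Finset.range (m + 1), t ^ i • ((i + 1 : ℝ) • c (i + 1)),
    ⟨_, fun i => Y.smul_mem _ (hc _), fun t => rfl⟩, fun t => ?_⟩
  rw [funext hpc]
  have h : HasDerivAt (fun t : ℝ => ∑ i ∈ Finset.range (m + 1 + 1), t ^ i • c i)
      (∑ i ∈ Finset.range (m + 1 + 1), ((i : ℝ) * t ^ (i - 1)) • c i) t :=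
    HasDerivAt.fun_sum fun i _ => (hasDerivAt_pow i t).smul_const (c i)
  convert h using 1
  rw [Finset.sum_range_succ' _ (m + 1)]
  simp [smul_smul, mul_comm]

theorem deriv_mem_timePoly {Y : Submodule ℝ V} {m : ℕ} {p : ℝ → V}
    (hp : p ∈ timePoly (m + 1) (Y : Set V)) : deriv p ∈ timePoly m (Y : Set V) := by
  obtain ⟨q, hq, h⟩ := exists_hasDerivAt_of_mem_timePoly hp
  rwa [show deriv p = q from funext fun t => (h t).deriv]

theorem differentiable_of_mem_timePoly {Y : Set V} {m : ℕ} {p : ℝ → V}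
    (hp : p ∈ timePoly (m + 1) Y) : Differentiable ℝ p := by
  obtain ⟨q, -, h⟩ := exists_hasDerivAt_of_mem_timePoly (Y := ⊤)
    (timePoly_mono (subset_univ Y) hp)
  exact fun t => (h t).differentiableAt

theorem deriv_mem_timePoly_univ {Y : Set V} {m : ℕ} {p : ℝ → V}
    (hp : p ∈ timePoly (m + 1) Y) : deriv p ∈ timePoly m (univ : Set V) :=
  deriv_mem_timePoly (Y := ⊤) (timePoly_mono (subset_univ Y) hp)

theorem integral_mem_timePoly [CompleteSpace V] {Y : Submodule ℝ V} {m : ℕ} {p : ℝ → V}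
    (hp : p ∈ timePoly m (Y : Set V)) (a : ℝ) :
    (fun t => ∫ s in a..t, p s) ∈ timePoly (m + 1) (Y : Set V) := by
  obtain ⟨c, hc, hpc⟩ := hp
  have hprim (t : ℝ) : ∫ s in a..t, p s = ∑ i ∈ Finset.range (m + 1),
      (C (1 / (i + 1 : ℝ)) * (X ^ (i + 1) - C (a ^ (i + 1)))).eval t • c i := by
    simp only [hpc]
    rw [intervalIntegral.integral_finsetSum fun i _ =>
      Continuous.intervalIntegrable (by fun_prop) _ _]
    refine Finset.sum_congr rfl fun i _ => ?_
    rw [intervalIntegral.integral_smul_const, integral_pow]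
    simp [div_eq_inv_mul]
  rw [funext hprim]
  refine sum_eval_smul_mem_timePoly _ (fun i hi => (natDegree_C_mul_le _ _).trans ?_) hc
  rw [natDegree_X_pow_sub_C]
  exact Finset.mem_range.1 hi

theorem exists_eq_sum_scaledLegendre_smul {Y : Set V} {a b : ℝ} (hab : a < b) {m : ℕ}
    {p : ℝ → V} (hp : p ∈ timePoly m Y) :
    ∃ e : ℕ → V, ∀ t, p t = ∑ k ∈ Finset.range (m + 1), (scaledLegendre a b k).eval t • e k := by
  obtain ⟨c, -, hpc⟩ := hp
  have hpow : ∀ i ∈ Finset.range (m + 1), ∃ α : ℕ → ℝ, ∀ t : ℝ, t ^ i =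
      ∑ k ∈ Finset.range (m + 1), α k * (scaledLegendre a b k).eval t := by
    intro i hi
    obtain ⟨α, hα⟩ := exists_eval_eq_sum_scaledLegendre hab (q := X ^ i) (m := m) (by
      rw [natDegree_X_pow]
      exact Finset.mem_range_succ_iff.1 hi)
    exact ⟨α, fun t => by simpa using hα t⟩
  choose! α hα using hpow
  refine ⟨fun k => ∑ i ∈ Finset.range (m + 1), α i k • c i, fun t => ?_⟩
  simp only [hpc, Finset.smul_sum, smul_smul]
  rw [Finset.sum_comm]
  refine Finset.sum_congr rfl fun i hi => ?_
  rw [hα i hi t, Finset.sum_smul]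
  simp only [mul_comm]

end TimePoly

section Extrapolation

theorem norm_sum_smul_sq_le {V ι : Type*} [NormedAddCommGroup V] [NormedSpace ℝ V] (s : Finset ι)
    {x w : ι → ℝ} (hw : ∀ k, 0 < w k) (e : ι → V) :
    ‖∑ k ∈ s, x k • e k‖ ^ 2 ≤ (∑ k ∈ s, x k ^ 2 / w k) * ∑ k ∈ s, w k * ‖e k‖ ^ 2 := by
  have htri : ‖∑ k ∈ s, x k • e k‖ ≤ ∑ k ∈ s, |x k| * ‖e k‖ :=
    (norm_sum_le _ _).trans_eq (by simp only [norm_smul, Real.norm_eq_abs])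
  refine (pow_le_pow_left₀ (norm_nonneg _) htri 2).trans ?_
  refine Finset.sum_sq_le_sum_mul_sum_of_sq_le_mul _ (fun k _ => ?_) (fun k _ => ?_) fun k _ => ?_
  · exact div_nonneg (sq_nonneg _) (hw k).le
  · exact mul_nonneg (hw k).le (sq_nonneg _)
  · have := (hw k).ne'
    rw [mul_pow, sq_abs]
    exact le_of_eq (by field_simp)

variable {H : Type*} [NormedAddCommGroup H] [InnerProductSpace ℝ H] {a b : ℝ}

theorem integral_norm_sq_sum_scaledLegendre (hab : a < b) (m : ℕ) (e : ℕ → H) :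
    ∫ t in a..b, ‖∑ k ∈ Finset.range m, (scaledLegendre a b k).eval t • e k‖ ^ 2 =
      ∑ k ∈ Finset.range m, (∫ t in a..b, (scaledLegendre a b k).eval t ^ 2) * ‖e k‖ ^ 2 := by
  have hexpand (t : ℝ) : ‖∑ k ∈ Finset.range m, (scaledLegendre a b k).eval t • e k‖ ^ 2 =
      ∑ j ∈ Finset.range m, ∑ k ∈ Finset.range m,
        (scaledLegendre a b j).eval t * (scaledLegendre a b k).eval t * inner ℝ (e j) (e k) := by
    rw [← real_inner_self_eq_norm_sq, sum_inner]
    simp only [inner_sum, real_inner_smul_left, real_inner_smul_right]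
    exact Finset.sum_congr rfl fun j _ => Finset.sum_congr rfl fun k _ => by ring
  simp only [hexpand]
  rw [intervalIntegral.integral_finsetSum fun j _ =>
    Continuous.intervalIntegrable (by fun_prop) _ _]
  refine Finset.sum_congr rfl fun j hj => ?_
  rw [intervalIntegral.integral_finsetSum fun k _ =>
      Continuous.intervalIntegrable (by fun_prop) _ _,
    Finset.sum_eq_single_of_mem j hj fun k _ hk => by
      rw [intervalIntegral.integral_mul_const, integral_scaledLegendre_mul hab hk.symm, zero_mul],
    intervalIntegral.integral_mul_const, real_inner_self_eq_norm_sq]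
  simp only [pow_two]

theorem integral_norm_sq_extrapolation_le (hab : a < b) {m : ℕ} {p : ℝ → H} {Y : Set H}
    (hp : p ∈ timePoly m Y) :
    ∫ t in b..(2 * b - a), ‖p t‖ ^ 2 ≤ extrapConst m ^ 2 * ∫ t in a..b, ‖p t‖ ^ 2 := by
  have hpc := continuous_of_mem_timePoly hp
  obtain ⟨e, he⟩ := exists_eq_sum_scaledLegendre_smul hab hp
  set n : ℕ → ℝ := fun k => ∫ t in a..b, (scaledLegendre a b k).eval t ^ 2
  have hnpos (k : ℕ) : 0 < n k := integral_scaledLegendre_sq_pos hab k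
  set w : ℝ → ℝ := fun t =>
    ∑ k ∈ Finset.range (m + 1), (scaledLegendre a b k).eval t ^ 2 / n k with hw
  have hwc : Continuous w := by fun_prop
  have hpointwise (t : ℝ) : ‖p t‖ ^ 2 ≤ w t * ∫ t in a..b, ‖p t‖ ^ 2 := by
    simp only [he, integral_norm_sq_sum_scaledLegendre hab]
    exact norm_sum_smul_sq_le _ hnpos e
  have hweight : ∫ t in b..(2 * b - a), w t = extrapConst m ^ 2 := by
    rw [extrapConst_sq, hw, intervalIntegral.integral_finsetSum fun k _ =>
      Continuous.intervalIntegrable (by fun_prop) _ _]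
    refine Finset.sum_congr rfl fun k _ => ?_
    rw [intervalIntegral.integral_div, integral_scaledLegendre_sq_next hab]
    exact mul_div_cancel_right₀ _ (hnpos k).ne'
  calc ∫ t in b..(2 * b - a), ‖p t‖ ^ 2
      ≤ ∫ t in b..(2 * b - a), w t * ∫ t in a..b, ‖p t‖ ^ 2 :=
        intervalIntegral.integral_mono_on (by linarith)
          (Continuous.intervalIntegrable (by fun_prop) _ _)
          ((hwc.mul_const _).intervalIntegrable _ _) fun t _ => hpointwise t
    _ = extrapConst m ^ 2 * ∫ t in a..b, ‖p t‖ ^ 2 := by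
        rw [intervalIntegral.integral_mul_const, hweight]

end Extrapolation

/-! ### The `L²`-projection in time -/

section LegendreProj

variable {V : Type*} [NormedAddCommGroup V] [NormedSpace ℝ V] {a b : ℝ} {m : ℕ} {w : ℝ → V}

/-- The `L²(a, b)`-orthogonal projection of `w` on the polynomials of degree at most `m`, written
as a truncated Legendre series so that `w` may have values in any Banach space. The derivative of
`timeProj (m + 1) a b u` is this projection of `u'`. -/
noncomputable def legendreProj (m : ℕ) (a b : ℝ) (w : ℝ → V) (t : ℝ) : V :=
  ∑ k ∈ Finset.range (m + 1), (scaledLegendre a b k).eval t •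
    (∫ s in a..b, (scaledLegendre a b k).eval s ^ 2)⁻¹ •
      ∫ s in a..b, (scaledLegendre a b k).eval s • w s

theorem legendreProj_mem_timePoly (hab : a < b) (m : ℕ) (w : ℝ → V) :
    legendreProj m a b w ∈ timePoly m (univ : Set V) :=
  sum_eval_smul_mem_timePoly (Y := ⊤) _ (fun k hk => by
    rw [natDegree_scaledLegendre hab]
    exact Finset.mem_range_succ_iff.1 hk) fun _ => trivial

theorem continuous_legendreProj (m : ℕ) (a b : ℝ) (w : ℝ → V) :
    Continuous (legendreProj m a b w) := by
  unfold legendreProj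
  fun_prop

theorem intervalIntegrable_eval_smul (q : ℝ[X]) (hw : IntervalIntegrable w volume a b) :
    IntervalIntegrable (fun t => q.eval t • w t) volume a b :=
  hw.continuousOn_smul q.continuousOn

theorem integral_scaledLegendre_smul_sum [CompleteSpace V] (hab : a < b) (e : ℕ → V) {j : ℕ}
    (hj : j ∈ Finset.range (m + 1)) :
    ∫ t in a..b, (scaledLegendre a b j).eval t •
        ∑ k ∈ Finset.range (m + 1), (scaledLegendre a b k).eval t • e k =
      (∫ t in a..b, (scaledLegendre a b j).eval t ^ 2) • e j := by
  simp only [Finset.smul_sum, smul_smul]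
  rw [intervalIntegral.integral_finsetSum fun k _ =>
    Continuous.intervalIntegrable (by fun_prop) _ _]
  simp only [intervalIntegral.integral_smul_const]
  rw [Finset.sum_eq_single_of_mem j hj fun k _ hk => by
    rw [integral_scaledLegendre_mul hab hk.symm, zero_smul]]
  simp only [pow_two]

theorem legendreProj_eq_self [CompleteSpace V] (hab : a < b) {Y : Set V} {p : ℝ → V}
    (hp : p ∈ timePoly m Y) : legendreProj m a b p = p := by
  obtain ⟨e, he⟩ := exists_eq_sum_scaledLegendre_smul hab hp
  funext t
  rw [legendreProj, he t]
  refine Finset.sum_congr rfl fun k hk => ?_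
  simp only [he, integral_scaledLegendre_smul_sum hab e hk,
    inv_smul_smul₀ (integral_scaledLegendre_sq_pos hab k).ne']

theorem integral_eval_smul_legendreProj [CompleteSpace V] (hab : a < b)
    (hw : IntervalIntegrable w volume a b) {q : ℝ[X]} (hq : q.natDegree ≤ m) :
    ∫ t in a..b, q.eval t • legendreProj m a b w t = ∫ t in a..b, q.eval t • w t := by
  obtain ⟨c, hc⟩ := exists_eval_eq_sum_scaledLegendre hab hq
  have hexpand (v : ℝ → V) (hv : IntervalIntegrable v volume a b) :
      ∫ t in a..b, q.eval t • v t = ∑ k ∈ Finset.range (m + 1),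
        c k • ∫ t in a..b, (scaledLegendre a b k).eval t • v t := by
    simp only [hc, Finset.sum_smul, mul_smul]
    rw [intervalIntegral.integral_finsetSum]
    · simp only [intervalIntegral.integral_smul]
    · exact fun k _ => (intervalIntegrable_eval_smul _ hv).smul (c k)
  rw [hexpand _ ((continuous_legendreProj m a b w).intervalIntegrable _ _), hexpand w hw]
  refine Finset.sum_congr rfl fun k hk => ?_
  simp only [legendreProj]
  rw [integral_scaledLegendre_smul_sum hab _ hk,
    smul_inv_smul₀ (integral_scaledLegendre_sq_pos hab k).ne']

theorem eq_legendreProj_of_orthogonal [CompleteSpace V] (hab : a < b)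
    (hw : IntervalIntegrable w volume a b) {Y : Set V} {p : ℝ → V} (hp : p ∈ timePoly m Y)
    (horth : ∀ q : ℝ[X], q.natDegree ≤ m → ∫ t in a..b, q.eval t • (w t - p t) = 0) :
    p = legendreProj m a b w := by
  have hpc := (continuous_of_mem_timePoly hp).intervalIntegrable (μ := volume) a b
  rw [← legendreProj_eq_self hab hp]
  funext t
  refine Finset.sum_congr rfl fun k hk => ?_
  have h := horth (scaledLegendre a b k) (by
    rw [natDegree_scaledLegendre hab]
    exact Finset.mem_range_succ_iff.1 hk)
  simp only [smul_sub] at h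
  rw [intervalIntegral.integral_sub (intervalIntegrable_eval_smul _ hw)
    (intervalIntegrable_eval_smul _ hpc), sub_eq_zero] at h
  rw [h]

theorem legendreProj_map [CompleteSpace V] {Z : Type*} [NormedAddCommGroup Z] [NormedSpace ℝ Z]
    [CompleteSpace Z] (A : V →L[ℝ] Z) (hw : IntervalIntegrable w volume a b) (m : ℕ) (t : ℝ) :
    legendreProj m a b (fun s => A (w s)) t = A (legendreProj m a b w t) := by
  simp only [legendreProj, map_sum, map_smul]
  refine Finset.sum_congr rfl fun k _ => ?_
  rw [← A.intervalIntegral_comp_comm (intervalIntegrable_eval_smul _ hw)]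
  simp only [map_smul]

theorem integral_inner_legendreProj_sub {H : Type*} [NormedAddCommGroup H] [InnerProductSpace ℝ H]
    [CompleteSpace H] (hab : a < b) {w : ℝ → H} (hw : IntervalIntegrable w volume a b) {Y : Set H}
    {r : ℝ → H} (hr : r ∈ timePoly m Y) :
    ∫ t in a..b, inner ℝ (legendreProj m a b w t - w t) (r t) = 0 := by
  obtain ⟨c, -, hrc⟩ := hr
  have hP := (continuous_legendreProj m a b w).intervalIntegrable (μ := volume) a b
  have hterm (i : ℕ) : IntervalIntegrable
      (fun t => (X ^ i : ℝ[X]).eval t • (legendreProj m a b w t - w t)) volume a b :=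
    intervalIntegrable_eval_smul _ (hP.sub hw)
  have hexpand (t : ℝ) : inner ℝ (legendreProj m a b w t - w t) (r t) =
      ∑ i ∈ Finset.range (m + 1),
        innerSL ℝ (c i) ((X ^ i : ℝ[X]).eval t • (legendreProj m a b w t - w t)) := by
    rw [hrc, inner_sum]
    refine Finset.sum_congr rfl fun i _ => ?_
    rw [innerSL_apply_apply, real_inner_smul_right, real_inner_smul_right, real_inner_comm,
      eval_pow, eval_X]
  simp only [hexpand]
  rw [intervalIntegral.integral_finsetSum fun i _ =>
    ⟨(innerSL ℝ (c i)).integrable_comp (hterm i).1, (innerSL ℝ (c i)).integrable_comp (hterm i).2⟩]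
  refine Finset.sum_eq_zero fun i hi => ?_
  rw [(innerSL ℝ (c i)).intervalIntegral_comp_comm (hterm i)]
  simp only [smul_sub]
  rw [intervalIntegral.integral_sub (intervalIntegrable_eval_smul _ hP)
    (intervalIntegrable_eval_smul _ hw), integral_eval_smul_legendreProj hab hw, sub_self, map_zero]
  rw [natDegree_X_pow]
  exact Finset.mem_range_succ_iff.1 hi

end LegendreProj

/-! ### Continuously differentiable functions of time and their projection -/

/-- `u` is continuous on `[a, b]` and differentiable on `(a, b)`, with derivative `u'` continuous
on `[a, b]`. Naming the derivative keeps the one-sided derivatives at `a` and `b` apart from the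
values of `deriv u` there. -/
structure C1On {V : Type*} [NormedAddCommGroup V] [NormedSpace ℝ V] (a b : ℝ) (u u' : ℝ → V) :
    Prop where
  hasDerivAt : ∀ t ∈ Ioo a b, HasDerivAt u (u' t) t
  continuousOn : ContinuousOn u (Icc a b)
  continuousOn_deriv : ContinuousOn u' (Icc a b)

namespace C1On

variable {V : Type*} [NormedAddCommGroup V] [NormedSpace ℝ V] {a b : ℝ} {u u' v v' : ℝ → V}

theorem of_mem_timePoly {Y : Set V} {m : ℕ} {p : ℝ → V} (hp : p ∈ timePoly (m + 1) Y) :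
    C1On a b p (deriv p) :=
  ⟨fun t _ => (differentiable_of_mem_timePoly hp t).hasDerivAt,
    (continuous_of_mem_timePoly hp).continuousOn,
    (continuous_of_mem_timePoly (deriv_mem_timePoly_univ hp)).continuousOn⟩

theorem sub (hu : C1On a b u u') (hv : C1On a b v v') : C1On a b (u - v) (u' - v') :=
  ⟨fun t ht => (hu.hasDerivAt t ht).sub (hv.hasDerivAt t ht),
    hu.continuousOn.sub hv.continuousOn, hu.continuousOn_deriv.sub hv.continuousOn_deriv⟩

theorem map {Z : Type*} [NormedAddCommGroup Z] [NormedSpace ℝ Z] (A : V →L[ℝ] Z)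
    (hu : C1On a b u u') : C1On a b (fun t => A (u t)) (fun t => A (u' t)) :=
  ⟨fun t ht => (A.hasFDerivAt.comp_hasDerivAt t (hu.hasDerivAt t ht)),
    A.continuous.comp_continuousOn hu.continuousOn,
    A.continuous.comp_continuousOn hu.continuousOn_deriv⟩

theorem mono {c d : ℝ} (hu : C1On a b u u') (hac : a ≤ c) (hdb : d ≤ b) : C1On c d u u' :=
  ⟨fun t ht => hu.hasDerivAt t ⟨hac.trans_lt ht.1, ht.2.trans_le hdb⟩,
    hu.continuousOn.mono (Icc_subset_Icc hac hdb),
    hu.continuousOn_deriv.mono (Icc_subset_Icc hac hdb)⟩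

theorem integral_congr {Z : Type*} [NormedAddCommGroup Z] [NormedSpace ℝ Z]
    (hu : C1On a b u u') (hab : a ≤ b) (F : ℝ → V → Z) :
    ∫ t in a..b, F t (deriv u t) = ∫ t in a..b, F t (u' t) := by
  refine intervalIntegral.integral_congr_ae ?_
  rw [uIoc_of_le hab]
  filter_upwards [volume.ae_ne b] with t ht hmem
  rw [(hu.hasDerivAt t ⟨hmem.1, lt_of_le_of_ne hmem.2 ht⟩).deriv]

theorem intervalIntegrable_deriv (hu : C1On a b u u') (hab : a ≤ b) :
    IntervalIntegrable u' volume a b :=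
  hu.continuousOn_deriv.intervalIntegrable_of_Icc hab

theorem integral_eq_sub [CompleteSpace V] (hu : C1On a b u u') (hab : a ≤ b) :
    ∫ t in a..b, u' t = u b - u a :=
  intervalIntegral.integral_eq_sub_of_hasDerivAt_of_le hab hu.continuousOn hu.hasDerivAt
    (hu.intervalIntegrable_deriv hab)

end C1On

theorem exists_derivative_eq (q : ℝ[X]) {m : ℕ} (hq : q.natDegree ≤ m) :
    ∃ Q : ℝ[X], derivative Q = q ∧ Q.natDegree ≤ m + 1 := by
  refine ⟨∑ i ∈ Finset.range (m + 1), C (q.coeff i / (i + 1)) * X ^ (i + 1), ?_,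
    natDegree_sum_le_of_forall_le _ _ fun i hi =>
      (natDegree_C_mul_X_pow_le _ _).trans (Finset.mem_range.1 hi)⟩
  conv_rhs => rw [q.as_sum_range_C_mul_X_pow' (Nat.lt_succ_of_le hq)]
  rw [derivative_sum]
  refine Finset.sum_congr rfl fun i _ => ?_
  have : (i + 1 : ℝ) ≠ 0 := by positivity
  rw [derivative_C_mul_X_pow]
  push_cast
  rw [div_mul_cancel₀ _ this]

theorem exists_derivative_eq_sub_C (q : ℝ[X]) {m : ℕ} (hq : q.natDegree ≤ m) {a b : ℝ}
    (hab : a < b) : ∃ (v : ℝ[X]) (κ : ℝ), derivative v = q - C κ ∧ v.natDegree ≤ m + 1 ∧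
      v.eval a = 0 ∧ v.eval b = 0 := by
  obtain ⟨Q, hQ, hQdeg⟩ := exists_derivative_eq q hq
  set κ := (Q.eval b - Q.eval a) / (b - a) with hκ
  have hba : b - a ≠ 0 := (sub_pos.2 hab).ne'
  refine ⟨Q - C (Q.eval a) - C κ * (X - C a), κ, by simp [hQ], ?_, by simp, by simp [hκ, hba]⟩
  refine (natDegree_sub_le _ _).trans (max_le ((natDegree_sub_C).trans_le hQdeg) ?_)
  exact (natDegree_C_mul_le _ _).trans ((natDegree_X_sub_C a).trans_le (by omega))

section TimeProj

variable {V : Type*} [NormedAddCommGroup V] [NormedSpace ℝ V] {a b : ℝ}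

theorem interp_left (hab : a < b) (u : ℝ → V) : interp a b u a = u a := by
  simp [interp, (sub_pos.2 hab).ne']

theorem interp_right (hab : a < b) (u : ℝ → V) : interp a b u b = u b := by
  simp [interp, (sub_pos.2 hab).ne']

theorem interp_mem_timePoly (a b : ℝ) (u : ℝ → V) (m : ℕ) :
    interp a b u ∈ timePoly (m + 1) (univ : Set V) := by
  refine ⟨fun i => if i = 0 then (b / (b - a)) • u a - (a / (b - a)) • u b else
    if i = 1 then (b - a)⁻¹ • (u b - u a) else 0, fun _ => mem_univ _, fun t => ?_⟩
  rw [Finset.sum_range_succ', Finset.sum_range_succ']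
  simp only [interp, Nat.add_eq_zero_iff, one_ne_zero, and_false, if_false, zero_add, if_true,
    Nat.add_eq_right, smul_zero, Finset.sum_const_zero, pow_zero, pow_one, one_smul]
  module

variable [CompleteSpace V] {u u' : ℝ → V} {m : ℕ}

theorem exists_isTimeProjZero (hab : a < b) (hu : C1On a b u u') (ha : u a = 0) (hb : u b = 0)
    (m : ℕ) : ∃ p, IsTimeProjZero (m + 1) a b u p := by
  have hu' := hu.intervalIntegrable_deriv hab.le
  have hP := continuous_legendreProj m a b u'
  have hderiv (t : ℝ) : deriv (fun t => ∫ s in a..t, legendreProj m a b u' s) t =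
      legendreProj m a b u' t := hP.deriv_integral _ a t
  refine ⟨fun t => ∫ s in a..t, legendreProj m a b u' s,
    integral_mem_timePoly (Y := ⊤) (legendreProj_mem_timePoly hab m u') a,
    intervalIntegral.integral_same, ?_, fun v hv _ _ => ?_⟩
  · have hone := integral_eval_smul_legendreProj hab hu' (q := 1) (by simp : _ ≤ m)
    simpa only [eval_one, one_smul, hu.integral_eq_sub hab.le, ha, hb, sub_zero] using hone
  · simp only [hderiv]
    rw [hu.integral_congr hab.le
      (fun t x => v.derivative.eval t • (x - legendreProj m a b u' t))]
    simp only [smul_sub]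
    rw [intervalIntegral.integral_sub (intervalIntegrable_eval_smul _ hu')
      (intervalIntegrable_eval_smul _ (hP.intervalIntegrable _ _)),
      integral_eval_smul_legendreProj hab hu' (by have := natDegree_derivative_le v; omega),
      sub_self]

/-- Subtracting its mean turns any polynomial of degree at most `m` into the derivative of an
admissible test polynomial; constants are tested by the fundamental theorem of calculus. -/
theorem integral_eval_smul_sub_deriv_isTimeProjZero {p : ℝ → V} (hab : a < b)
    (hu : C1On a b u u') (ha : u a = 0) (hb : u b = 0) (hp : IsTimeProjZero (m + 1) a b u p)
    {q : ℝ[X]} (hq : q.natDegree ≤ m) :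
    ∫ t in a..b, q.eval t • (u' t - deriv p t) = 0 := by
  obtain ⟨hpm, hpa, hpb, horth⟩ := hp
  obtain ⟨v, κ, hv, hvdeg, hva, hvb⟩ := exists_derivative_eq_sub_C q hq hab
  have hdiff := hu.sub (C1On.of_mem_timePoly hpm)
  have hint := hdiff.intervalIntegrable_deriv hab.le
  have hmean : ∫ t in a..b, (u' - deriv p) t = 0 := by
    rw [hdiff.integral_eq_sub hab.le]
    simp [ha, hb, hpa, hpb]
  have htest := horth v hvdeg hva hvb
  rw [hu.integral_congr hab.le (fun t x => v.derivative.eval t • (x - deriv p t)), hv] at htest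
  have hsplit (t : ℝ) : q.eval t • (u' t - deriv p t) =
      (q - C κ).eval t • (u' - deriv p) t + κ • (u' - deriv p) t := by
    rw [← add_smul]
    simp
  simp only [hsplit]
  rw [intervalIntegral.integral_add (intervalIntegrable_eval_smul _ hint)
      (show IntervalIntegrable (fun t => κ • (u' - deriv p) t) volume a b from hint.smul κ),
    intervalIntegral.integral_smul, hmean, smul_zero, add_zero]
  exact htest

theorem timeProj_spec (hab : a < b) (hu : C1On a b u u') (m : ℕ) :
    timeProj (m + 1) a b u ∈ timePoly (m + 1) (univ : Set V) ∧
      timeProj (m + 1) a b u a = u a ∧ timeProj (m + 1) a b u b = u b ∧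
      deriv (timeProj (m + 1) a b u) = legendreProj m a b u' := by
  have hIm := interp_mem_timePoly a b u m
  have hw := hu.sub (C1On.of_mem_timePoly hIm)
  have hwa : (u - interp a b u) a = 0 := by simp [interp_left hab]
  have hwb : (u - interp a b u) b = 0 := by simp [interp_right hab]
  have hp : IsTimeProjZero (m + 1) a b (u - interp a b u)
      (timeProjZero (m + 1) a b (u - interp a b u)) :=
    Classical.epsilon_spec (exists_isTimeProjZero hab hw hwa hwb m)
  have hmem : timeProj (m + 1) a b u ∈ timePoly (m + 1) (univ : Set V) :=
    add_mem_timePoly (Y := ⊤) hIm hp.1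
  refine ⟨hmem, by simp [timeProj, interp_left hab, hp.2.1],
    by simp [timeProj, interp_right hab, hp.2.2.1], ?_⟩
  refine eq_legendreProj_of_orthogonal hab (hu.intervalIntegrable_deriv hab.le)
    (deriv_mem_timePoly_univ hmem) fun q hq => ?_
  rw [← integral_eval_smul_sub_deriv_isTimeProjZero hab hw hwa hwb hp hq]
  refine intervalIntegral.integral_congr fun t _ => ?_
  have hadd : deriv (timeProj (m + 1) a b u) t = deriv (interp a b u) t +
      deriv (timeProjZero (m + 1) a b (u - interp a b u)) t :=
    deriv_add (differentiable_of_mem_timePoly hIm t) (differentiable_of_mem_timePoly hp.1 t)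
  simp only [hadd, Pi.sub_apply, sub_sub]

theorem timeProj_mem_timePoly (hab : a < b) (hu : C1On a b u u') (m : ℕ) :
    timeProj (m + 1) a b u ∈ timePoly (m + 1) (univ : Set V) :=
  (timeProj_spec hab hu m).1

theorem timeProj_left (hab : a < b) (hu : C1On a b u u') (m : ℕ) :
    timeProj (m + 1) a b u a = u a :=
  (timeProj_spec hab hu m).2.1

theorem timeProj_right (hab : a < b) (hu : C1On a b u u') (m : ℕ) :
    timeProj (m + 1) a b u b = u b :=
  (timeProj_spec hab hu m).2.2.1

theorem deriv_timeProj (hab : a < b) (hu : C1On a b u u') (m : ℕ) :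
    deriv (timeProj (m + 1) a b u) = legendreProj m a b u' :=
  (timeProj_spec hab hu m).2.2.2

theorem timeProj_eq_add_integral (hab : a < b) (hu : C1On a b u u') (m : ℕ) (t : ℝ) :
    timeProj (m + 1) a b u t = u a + ∫ s in a..t, legendreProj m a b u' s := by
  have hdiff := differentiable_of_mem_timePoly (timeProj_mem_timePoly hab hu m)
  rw [← timeProj_left hab hu m, ← sub_eq_iff_eq_add', ← deriv_timeProj hab hu m]
  refine (intervalIntegral.integral_deriv_eq_sub (fun s _ => hdiff s) ?_).symm
  rw [deriv_timeProj hab hu m]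
  exact (continuous_legendreProj m a b u').intervalIntegrable _ _

theorem timeProj_map {Z : Type*} [NormedAddCommGroup Z] [NormedSpace ℝ Z] [CompleteSpace Z]
    (A : V →L[ℝ] Z) (hab : a < b) (hu : C1On a b u u') (m : ℕ) (t : ℝ) :
    timeProj (m + 1) a b (fun s => A (u s)) t = A (timeProj (m + 1) a b u t) := by
  have hint := (continuous_legendreProj m a b u').intervalIntegrable (μ := volume) a t
  simp only [timeProj_eq_add_integral hab (hu.map A), timeProj_eq_add_integral hab hu, map_add,
    ← A.intervalIntegral_comp_comm hint, legendreProj_map A (hu.intervalIntegrable_deriv hab.le)]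

end TimeProj

/-! ### The Hilbert space `H¹₀(Ω)` -/

section H01

variable {d : ℕ} {Ω : Set (EuclideanSpace ℝ (Fin d))}

instance instCompleteSpaceH01 : CompleteSpace (H01 Ω) :=
  (Submodule.isClosed_topologicalClosure _).completeSpace_coe

/-- The inclusion `H¹₀(Ω) → L²(Ω)` as a continuous linear map. -/
noncomputable def toL2L : H01 Ω →L[ℝ] L2 Ω :=
  (WithLp.fstL 2 ℝ (L2 Ω) (L2Vec Ω)).comp (h01Submodule Ω).subtypeL

/-- The weak gradient as a continuous linear map. -/
noncomputable def gradL : H01 Ω →L[ℝ] L2Vec Ω :=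
  (WithLp.sndL 2 ℝ (L2 Ω) (L2Vec Ω)).comp (h01Submodule Ω).subtypeL

@[fun_prop]
theorem continuous_toL2 : Continuous (toL2 : H01 Ω → L2 Ω) := (toL2L (Ω := Ω)).continuous

@[fun_prop]
theorem continuous_grad : Continuous (grad : H01 Ω → L2Vec Ω) := (gradL (Ω := Ω)).continuous

@[fun_prop]
theorem continuousOn_toL2_comp {X : Type*} [TopologicalSpace X] {w : X → H01 Ω} {s : Set X}
    (hw : ContinuousOn w s) : ContinuousOn (fun t => toL2 (w t)) s :=
  continuous_toL2.comp_continuousOn hw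

@[fun_prop]
theorem continuousOn_grad_comp {X : Type*} [TopologicalSpace X] {w : X → H01 Ω} {s : Set X}
    (hw : ContinuousOn w s) : ContinuousOn (fun t => grad (w t)) s :=
  continuous_grad.comp_continuousOn hw

theorem toL2_add (v w : H01 Ω) : toL2 (v + w) = toL2 v + toL2 w := rfl
theorem toL2_sub (v w : H01 Ω) : toL2 (v - w) = toL2 v - toL2 w := rfl
theorem toL2_smul (c : ℝ) (w : H01 Ω) : toL2 (c • w) = c • toL2 w := rfl
theorem grad_add (v w : H01 Ω) : grad (v + w) = grad v + grad w := rfl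
theorem grad_sub (v w : H01 Ω) : grad (v - w) = grad v - grad w := rfl
theorem grad_smul (c : ℝ) (w : H01 Ω) : grad (c • w) = c • grad w := rfl

theorem eq_zero_of_toL2_of_grad {w : H01 Ω} (h : toL2 w = 0) (h' : grad w = 0) : w = 0 :=
  Subtype.ext (WithLp.ofLp_injective 2 (Prod.ext h h'))

theorem inner_add_inner_eq_zero_of_testPairs {g : L2 Ω} {F : L2Vec Ω}
    (h : ∀ z ∈ testPairs Ω, inner ℝ g z.fst + inner ℝ F z.snd = 0) (w : H01 Ω) :
    inner ℝ g (toL2 w) + inner ℝ F (grad w) = 0 := by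
  set Λ : L2Pair Ω →L[ℝ] ℝ := innerSL ℝ (WithLp.toLp 2 (g, F))
  have hle : h01Submodule Ω ≤ LinearMap.ker (Λ : L2Pair Ω →ₗ[ℝ] ℝ) :=
    Submodule.topologicalClosure_minimal _ (Submodule.span_le.2 fun z hz => h z hz) Λ.isClosed_ker
  exact hle w.2

theorem isFiniteMeasure_restrict (hΩb : Bornology.IsBounded Ω) :
    IsFiniteMeasure (volume.restrict Ω) :=
  ⟨by simpa using hΩb.measure_lt_top⟩

theorem memLp_of_continuous (hΩo : IsOpen Ω) (hΩb : Bornology.IsBounded Ω) {G : Type*}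
    [NormedAddCommGroup G] {F : EuclideanSpace ℝ (Fin d) → G} (hF : Continuous F) (p : ENNReal) :
    MemLp F p (volume.restrict Ω) := by
  have := isFiniteMeasure_restrict hΩb
  obtain ⟨C, hC⟩ := hΩb.isCompact_closure.exists_bound_of_continuousOn hF.continuousOn
  exact MemLp.of_bound hF.aestronglyMeasurable C
    (ae_restrict_of_forall_mem hΩo.measurableSet fun x hx => hC x (subset_closure hx))

theorem integrable_continuous_smul (hΩo : IsOpen Ω) (hΩb : Bornology.IsBounded Ω) {G : Type*}
    [NormedAddCommGroup G] [NormedSpace ℝ G] {ψ : EuclideanSpace ℝ (Fin d) → ℝ}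
    (hψ : Continuous ψ) {F : EuclideanSpace ℝ (Fin d) → G} (hF : MemLp F 2 (volume.restrict Ω)) :
    Integrable (fun x => ψ x • F x) (volume.restrict Ω) :=
  memLp_one_iff_integrable.1 (hF.smul (memLp_of_continuous hΩo hΩb hψ 2))

theorem inner_toLp {G : Type*} [NormedAddCommGroup G] [InnerProductSpace ℝ G]
    {F : EuclideanSpace ℝ (Fin d) → G} (hF : MemLp F 2 (volume.restrict Ω))
    (z : Lp G 2 (volume.restrict Ω)) :
    inner ℝ (hF.toLp F) z = ∫ x in Ω, inner ℝ (F x) (z x) := by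
  rw [L2.inner_def]
  refine integral_congr_ae ?_
  filter_upwards [hF.coeFn_toLp] with x hx
  rw [hx]

theorem continuous_gradient {φ : EuclideanSpace ℝ (Fin d) → ℝ} (hφ : ContDiff ℝ 1 φ) :
    Continuous (gradient φ) :=
  (InnerProductSpace.toDual ℝ _).symm.continuous.comp (hφ.continuous_fderiv one_ne_zero)

theorem continuous_fderiv_apply_const {φ : EuclideanSpace ℝ (Fin d) → ℝ} (hφ : ContDiff ℝ 1 φ)
    (v : EuclideanSpace ℝ (Fin d)) : Continuous fun x => fderiv ℝ φ x v :=
  (hφ.continuous_fderiv one_ne_zero).clm_apply continuous_const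

theorem exists_toL2_ae_eq_of_hasCompactSupport (hΩo : IsOpen Ω) (hΩb : Bornology.IsBounded Ω)
    {φ : EuclideanSpace ℝ (Fin d) → ℝ} (hφ : ContDiff ℝ ∞ φ) (hc : HasCompactSupport φ)
    (hs : tsupport φ ⊆ Ω) :
    ∃ w : H01 Ω, toL2 w =ᵐ[volume.restrict Ω] φ ∧ grad w =ᵐ[volume.restrict Ω] gradient φ := by
  have hval := memLp_of_continuous hΩo hΩb hφ.continuous 2
  have hgrad := memLp_of_continuous hΩo hΩb (continuous_gradient (hφ.of_le (mod_cast le_top))) 2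
  exact ⟨⟨WithLp.toLp 2 (hval.toLp φ, hgrad.toLp (gradient φ)),
    Submodule.le_topologicalClosure _ (Submodule.subset_span
      ⟨φ, hφ, hc, hs, hval.coeFn_toLp, hgrad.coeFn_toLp⟩)⟩, hval.coeFn_toLp, hgrad.coeFn_toLp⟩

theorem setIntegral_fderiv_mul_eq_neg {φ ψ : EuclideanSpace ℝ (Fin d) → ℝ} (hφ : ContDiff ℝ 1 φ)
    (hc : HasCompactSupport φ) (hs : tsupport φ ⊆ Ω) (hψ : ContDiff ℝ 1 ψ)
    (v : EuclideanSpace ℝ (Fin d)) :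
    ∫ x in Ω, fderiv ℝ ψ x v * φ x = - ∫ x in Ω, ψ x * fderiv ℝ φ x v := by
  have hφd := continuous_fderiv_apply_const hφ v
  have hφ_zero (x) (hx : x ∉ Ω) : φ x = 0 := image_eq_zero_of_notMem_tsupport (notMem_subset hs hx)
  have hφd_zero (x) (hx : x ∉ Ω) : fderiv ℝ φ x v = 0 := by
    rw [image_eq_zero_of_notMem_tsupport
      (notMem_subset ((tsupport_fderiv_subset ℝ).trans hs) hx), zero_apply]
  have hcd : HasCompactSupport fun x => fderiv ℝ φ x v :=
    (hc.fderiv ℝ).comp_left (g := fun A : EuclideanSpace ℝ (Fin d) →L[ℝ] ℝ => A v) rfl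
  rw [setIntegral_eq_integral_of_forall_compl_eq_zero fun x hx => by rw [hφ_zero x hx, mul_zero],
    setIntegral_eq_integral_of_forall_compl_eq_zero fun x hx => by rw [hφd_zero x hx, mul_zero],
    integral_mul_fderiv_eq_neg_fderiv_mul_of_integrable, neg_neg]
  · exact ((continuous_fderiv_apply_const hψ v).mul hφ.continuous).integrable_of_hasCompactSupport
      hc.mul_left
  · exact (hψ.continuous.mul hφd).integrable_of_hasCompactSupport hcd.mul_left
  · exact (hψ.continuous.mul hφ.continuous).integrable_of_hasCompactSupport hc.mul_left
  · exact fun x _ => (hψ.differentiable one_ne_zero).differentiableAt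
  · exact fun x _ => (hφ.differentiable one_ne_zero).differentiableAt

theorem integral_fderiv_mul_toL2 (hΩo : IsOpen Ω) (hΩb : Bornology.IsBounded Ω) (w : H01 Ω)
    {ψ : EuclideanSpace ℝ (Fin d) → ℝ} (hψ : ContDiff ℝ 1 ψ) (v : EuclideanSpace ℝ (Fin d)) :
    ∫ x in Ω, fderiv ℝ ψ x v * toL2 w x = - ∫ x in Ω, ψ x * inner ℝ v (grad w x) := by
  have hψd := memLp_of_continuous hΩo hΩb (continuous_fderiv_apply_const hψ v) 2
  have hψv := memLp_of_continuous hΩo hΩb (hψ.continuous.smul (continuous_const (y := v))) 2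
  have hinner (z : L2Pair Ω) :
      inner ℝ (hψd.toLp _) z.fst + inner ℝ (hψv.toLp _) z.snd =
        (∫ x in Ω, fderiv ℝ ψ x v * z.fst x) + ∫ x in Ω, ψ x * inner ℝ v (z.snd x) := by
    simp only [inner_toLp, Pi.smul_apply', real_inner_smul_left, RCLike.inner_apply, conj_trivial,
      mul_comm]
  refine eq_neg_of_add_eq_zero_left ((hinner w).symm.trans
    (inner_add_inner_eq_zero_of_testPairs ?_ w))
  rintro z ⟨φ, hφ, hc, hs, hfst, hsnd⟩
  rw [hinner, integral_congr_ae (g := fun x => fderiv ℝ ψ x v * φ x),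
    integral_congr_ae (f := fun x => ψ x * inner ℝ v (z.snd x))
      (g := fun x => ψ x * fderiv ℝ φ x v),
    setIntegral_fderiv_mul_eq_neg (hφ.of_le (mod_cast le_top)) hc hs hψ, neg_add_cancel]
  · filter_upwards [hsnd] with x hx
    rw [hx, inner_gradient_right, conj_trivial]
  · filter_upwards [hfst] with x hx
    rw [hx]

theorem Lp_eq_zero_of_integral_smul (hΩo : IsOpen Ω) {G : Type*} [NormedAddCommGroup G]
    [NormedSpace ℝ G] [CompleteSpace G] (g : Lp G 2 (volume.restrict Ω))
    (h : ∀ ψ : EuclideanSpace ℝ (Fin d) → ℝ, ContDiff ℝ ∞ ψ → HasCompactSupport ψ →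
      tsupport ψ ⊆ Ω → ∫ x in Ω, ψ x • g x = 0) : g = 0 := by
  have hloc : LocallyIntegrableOn g Ω volume :=
    locallyIntegrableOn_of_locallyIntegrable_restrict ((Lp.memLp g).locallyIntegrable (by norm_num))
  rw [Lp.eq_zero_iff_ae_eq_zero, Filter.EventuallyEq, ae_restrict_iff' hΩo.measurableSet]
  refine hΩo.ae_eq_zero_of_integral_contDiff_smul_eq_zero hloc fun ψ hψ hc hs => ?_
  rw [← h ψ hψ hc hs, setIntegral_eq_integral_of_forall_compl_eq_zero fun x hx => ?_]
  rw [image_eq_zero_of_notMem_tsupport (notMem_subset hs hx), zero_smul]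

theorem grad_ae_eq_gradient (hΩo : IsOpen Ω) (hΩb : Bornology.IsBounded Ω) {w : H01 Ω}
    {φ : EuclideanSpace ℝ (Fin d) → ℝ} (hφ : ContDiff ℝ 1 φ)
    (hw : toL2 w =ᵐ[volume.restrict Ω] φ) : grad w =ᵐ[volume.restrict Ω] gradient φ := by
  have hF := memLp_of_continuous hΩo hΩb (continuous_gradient hφ) 2
  suffices h : grad w = hF.toLp _ from h ▸ hF.coeFn_toLp
  refine sub_eq_zero.1 (Lp_eq_zero_of_integral_smul hΩo _ fun ψ hψ hc hs =>
    ext_inner_left ℝ fun v => ?_)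
  obtain ⟨Ψ, hΨ, hΨgrad⟩ := exists_toL2_ae_eq_of_hasCompactSupport hΩo hΩb hψ hc hs
  have hψw := integral_fderiv_mul_toL2 hΩo hΩb w (hψ.of_le (mod_cast le_top)) v
  have hψφ := integral_fderiv_mul_toL2 hΩo hΩb Ψ hφ v
  have hint {F : EuclideanSpace ℝ (Fin d) → EuclideanSpace ℝ (Fin d)}
      (hF : MemLp F 2 (volume.restrict Ω)) :
      Integrable (fun x => ψ x * inner ℝ v (F x)) (volume.restrict Ω) :=
    integrable_continuous_smul hΩo hΩb hψ.continuous ((innerSL ℝ v).comp_memLp' hF)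
  rw [inner_zero_right,
    ← integral_inner (integrable_continuous_smul hΩo hΩb hψ.continuous (Lp.memLp _))]
  calc ∫ x in Ω, inner ℝ v (ψ x • (grad w - hF.toLp _ : L2Vec Ω) x)
      = ∫ x in Ω, (ψ x * inner ℝ v (grad w x) - ψ x * inner ℝ v (gradient φ x)) := by
        refine integral_congr_ae ?_
        filter_upwards [Lp.coeFn_sub (grad w) (hF.toLp _), hF.coeFn_toLp] with x hx hx'
        rw [hx, Pi.sub_apply, hx', real_inner_smul_right, inner_sub_right, mul_sub]
    _ = -(∫ x in Ω, fderiv ℝ ψ x v * toL2 w x) - ∫ x in Ω, fderiv ℝ φ x v * toL2 Ψ x := by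
        rw [integral_sub (hint (Lp.memLp _)) (hint hF), hψw, neg_neg]
        congr 1
        refine integral_congr_ae ?_
        filter_upwards [hΨ] with x hx
        rw [hx, inner_gradient_right, conj_trivial, mul_comm]
    _ = 0 := by
        rw [hψφ, neg_sub_neg, sub_eq_zero]
        refine integral_congr_ae ?_
        filter_upwards [hw, hΨgrad] with x hx hx'
        rw [hx, hx', inner_gradient_right, conj_trivial, mul_comm]

theorem toL2_injective (hΩo : IsOpen Ω) (hΩb : Bornology.IsBounded Ω) :
    Function.Injective (toL2 : H01 Ω → L2 Ω) := by
  refine (injective_iff_map_eq_zero (toL2L : H01 Ω →L[ℝ] L2 Ω)).2 fun w hw =>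
    eq_zero_of_toL2_of_grad hw (Lp.eq_zero_iff_ae_eq_zero.2 ?_)
  rw [← gradient_const' (𝕜 := ℝ) 0]
  exact grad_ae_eq_gradient hΩo hΩb contDiff_const (Lp.eq_zero_iff_ae_eq_zero.1 hw)

theorem fderiv_coord_mul {φ : EuclideanSpace ℝ (Fin d) → ℝ} {x : EuclideanSpace ℝ (Fin d)}
    (hφ : DifferentiableAt ℝ φ x) (i : Fin d) :
    fderiv ℝ (fun y => y i * φ y) x (EuclideanSpace.single i 1) =
      φ x + x i * fderiv ℝ φ x (EuclideanSpace.single i 1) := by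
  have hcoord := (EuclideanSpace.proj (𝕜 := ℝ) i : EuclideanSpace ℝ (Fin d) →L[ℝ] ℝ).hasFDerivAt
    (x := x)
  have hprod : HasFDerivAt (fun y : EuclideanSpace ℝ (Fin d) => y i * φ y) _ x :=
    hcoord.mul hφ.hasFDerivAt
  simp [hprod.fderiv, add_comm]

theorem integral_mul_toL2_eq_neg_of_grad_eq_zero (hΩo : IsOpen Ω) (hΩb : Bornology.IsBounded Ω)
    {w : H01 Ω} (hw : grad w = 0) {φ : EuclideanSpace ℝ (Fin d) → ℝ} (hφ : ContDiff ℝ 1 φ)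
    (i : Fin d) :
    ∫ x in Ω, φ x * toL2 w x =
      -∫ x in Ω, x i * fderiv ℝ φ x (EuclideanSpace.single i 1) * toL2 w x := by
  have hcoord : ContDiff ℝ 1 fun x : EuclideanSpace ℝ (Fin d) => x i :=
    (EuclideanSpace.proj (𝕜 := ℝ) i).contDiff
  have hzero := integral_fderiv_mul_toL2 hΩo hΩb w (hcoord.mul hφ) (EuclideanSpace.single i 1)
  rw [integral_eq_zero_of_ae (f := fun x => _ * inner ℝ _ (grad w x))
    ((Lp.eq_zero_iff_ae_eq_zero.1 hw).mono fun x hx => by simp [hx]), neg_zero] at hzero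
  have hint := integrable_continuous_smul hΩo hΩb hφ.continuous (Lp.memLp (toL2 w))
  have hint' := integrable_continuous_smul hΩo hΩb (hcoord.continuous.mul
    (continuous_fderiv_apply_const hφ (EuclideanSpace.single i 1))) (Lp.memLp (toL2 w))
  rw [eq_neg_iff_add_eq_zero, ← hzero]
  refine (integral_add hint hint').symm.trans (integral_congr_ae (.of_forall fun x => ?_))
  simp only [smul_eq_mul, Pi.mul_apply, fderiv_coord_mul (hφ.differentiable one_ne_zero x),
    add_mul]

/-- When `∇w = 0`, integrating `w` against `∂ᵢ(xᵢ φ)` shows that `(w, xᵢ w eᵢ)` is orthogonal to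
every test pair `(φ, ∇φ)`, hence also to `(w, ∇w) = (w, 0)`. -/
theorem eq_zero_of_grad_eq_zero (hd : 0 < d) (hΩo : IsOpen Ω) (hΩb : Bornology.IsBounded Ω)
    {w : H01 Ω} (hw : grad w = 0) : w = 0 := by
  let i : Fin d := ⟨0, hd⟩
  let e : EuclideanSpace ℝ (Fin d) := EuclideanSpace.single i 1
  have hF : MemLp (fun x => (x i * toL2 w x) • e) 2 (volume.restrict Ω) :=
    (ContinuousLinearMap.toSpanSingleton ℝ e).comp_memLp' ((Lp.memLp (toL2 w)).smul
      (memLp_of_continuous hΩo hΩb (EuclideanSpace.proj (𝕜 := ℝ) i).continuous ⊤))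
  have horth : ∀ z ∈ testPairs Ω, inner ℝ (toL2 w) z.fst + inner ℝ (hF.toLp _) z.snd = 0 := by
    rintro z ⟨φ, hφ, -, -, hfst, hsnd⟩
    have hfirst : inner ℝ (toL2 w) z.fst = ∫ x in Ω, φ x * toL2 w x :=
      (L2.inner_def _ _).trans (integral_congr_ae (hfst.mono fun x hx => by simp [hx]))
    have hsecond : inner ℝ (hF.toLp _) z.snd = ∫ x in Ω, x i * fderiv ℝ φ x e * toL2 w x := by
      refine (inner_toLp hF _).trans (integral_congr_ae (hsnd.mono fun x hx => ?_))
      simp only [hx, inner_gradient_right, conj_trivial, map_smul, smul_eq_mul]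
      ring
    rw [hfirst, hsecond, integral_mul_toL2_eq_neg_of_grad_eq_zero hΩo hΩb hw
      (hφ.of_le (mod_cast le_top)) i, neg_add_cancel]
  have hself := inner_add_inner_eq_zero_of_testPairs horth w
  rw [hw, inner_zero_right, add_zero, inner_self_eq_zero] at hself
  exact eq_zero_of_toL2_of_grad hself hw

end H01

/-! ### Polynomials in space: the elliptic projection and the Laplacian -/

section PolySpace

variable {d : ℕ} {Ω : Set (EuclideanSpace ℝ (Fin d))} {M : ℕ}

theorem contDiff_eval (p : MvPolynomial (Fin d) ℝ) (n : WithTop ℕ∞) :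
    ContDiff ℝ n fun x : EuclideanSpace ℝ (Fin d) => MvPolynomial.eval (fun i => x i) p := by
  induction p using MvPolynomial.induction_on with
  | C c => simpa only [MvPolynomial.eval_C] using contDiff_const
  | add p q hp hq => simpa only [map_add] using hp.add hq
  | mul_X p i hp =>
    simp only [map_mul, MvPolynomial.eval_X]
    exact hp.mul (EuclideanSpace.proj (𝕜 := ℝ) i).contDiff

/-- `P_M^0(Ω)` as a subspace of `H¹₀(Ω)`. -/
noncomputable def polySubmodule (Ω : Set (EuclideanSpace ℝ (Fin d))) (M : ℕ) :
    Submodule ℝ (H01 Ω) where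
  carrier := polySpace Ω M
  zero_mem' := ⟨0, by simp, by simp, (Lp.coeFn_zero ℝ 2 _).trans (.of_forall fun x => by simp)⟩
  add_mem' := by
    rintro v w ⟨p, hp, hp_zero, hvp⟩ ⟨q, hq, hq_zero, hwq⟩
    refine ⟨p + q, (MvPolynomial.totalDegree_add _ _).trans (max_le hp hq), fun x hx => by
      rw [map_add, hp_zero x hx, hq_zero x hx, add_zero], ?_⟩
    filter_upwards [Lp.coeFn_add (toL2 v) (toL2 w), hvp, hwq] with x hx hv hw
    rw [toL2_add, hx, Pi.add_apply, hv, hw, map_add]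
  smul_mem' := by
    rintro c w ⟨p, hp, hp_zero, hwp⟩
    refine ⟨c • p, (MvPolynomial.totalDegree_smul_le _ _).trans hp, fun x hx => by
      rw [MvPolynomial.smul_eval, hp_zero x hx, mul_zero], ?_⟩
    filter_upwards [Lp.coeFn_smul c (toL2 w), hwp] with x hx hw
    rw [toL2_smul, hx, Pi.smul_apply, hw, MvPolynomial.smul_eval, smul_eq_mul]

theorem finiteDimensional_polySubmodule (hΩo : IsOpen Ω) (hΩb : Bornology.IsBounded Ω) (M : ℕ) :
    FiniteDimensional ℝ (polySubmodule Ω M) := by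
  have hp (p : MvPolynomial (Fin d) ℝ) :=
    memLp_of_continuous hΩo hΩb (contDiff_eval p 0).continuous 2
  let Φ : MvPolynomial.restrictTotalDegree (Fin d) ℝ M →ₗ[ℝ] L2 Ω :=
    { toFun := fun p => (hp p).toLp _
      map_add' := fun p q => by
        rw [← MemLp.toLp_add]
        exact MemLp.toLp_congr _ _ (.of_forall fun x => by simp)
      map_smul' := fun c p => by
        rw [RingHom.id_apply, ← MemLp.toLp_const_smul]
        exact MemLp.toLp_congr _ _ (.of_forall fun x => by simp) }
  have hmem (w : polySubmodule Ω M) : toL2L (w : H01 Ω) ∈ LinearMap.range Φ := by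
    obtain ⟨w, p, hpM, -, hwp⟩ := w
    exact ⟨⟨p, (MvPolynomial.mem_restrictTotalDegree _ _ _).2 hpM⟩,
      Lp.ext ((hp p).coeFn_toLp.trans hwp.symm)⟩
  refine FiniteDimensional.of_injective (LinearMap.codRestrict _
    ((toL2L : H01 Ω →L[ℝ] L2 Ω).toLinearMap ∘ₗ (polySubmodule Ω M).subtype) hmem) fun v w hvw => ?_
  exact Subtype.ext (toL2_injective hΩo hΩb (congrArg Subtype.val hvw))

theorem IsSpaceProj.unique (hd : 0 < d) (hΩo : IsOpen Ω) (hΩb : Bornology.IsBounded Ω)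
    {w p q : H01 Ω} (hp : IsSpaceProj M w p) (hq : IsSpaceProj M w q) : p = q := by
  have hmem : p - q ∈ polySpace Ω M := (polySubmodule Ω M).sub_mem hp.1 hq.1
  have hgrad : grad (p - q) = grad (p - w) - grad (q - w) := by
    rw [← grad_sub, sub_sub_sub_cancel_right]
  refine sub_eq_zero.1 (eq_zero_of_grad_eq_zero hd hΩo hΩb (inner_self_eq_zero (𝕜 := ℝ).1 ?_))
  conv_lhs => arg 2; rw [hgrad]
  rw [inner_sub_left, hp.2 _ hmem, hq.2 _ hmem, sub_zero]

theorem exists_isSpaceProj_clm (hd : 0 < d) (hΩo : IsOpen Ω) (hΩb : Bornology.IsBounded Ω)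
    (M : ℕ) : ∃ A : H01 Ω →L[ℝ] H01 Ω, ∀ w, IsSpaceProj M w (A w) := by
  have := finiteDimensional_polySubmodule hΩo hΩb M
  let G : polySubmodule Ω M →ₗ[ℝ] L2Vec Ω :=
    (gradL : H01 Ω →L[ℝ] L2Vec Ω).toLinearMap ∘ₗ (polySubmodule Ω M).subtype
  have hG : Function.Injective G := (injective_iff_map_eq_zero _).2 fun p hp =>
    Subtype.ext (eq_zero_of_grad_eq_zero hd hΩo hΩb hp)
  let R := LinearMap.range G
  let e : polySubmodule Ω M ≃ₗ[ℝ] R := LinearEquiv.ofInjective G hG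
  refine ⟨(polySubmodule Ω M).subtypeL.comp ((e.symm.toLinearMap.toContinuousLinearMap).comp
    (R.orthogonalProjectionOnto.comp gradL)), fun w => ?_⟩
  have hgrad : G (e.symm (R.orthogonalProjectionOnto (grad w))) =
      R.orthogonalProjectionOnto (grad w) :=
    congrArg Subtype.val (e.apply_symm_apply (R.orthogonalProjectionOnto (grad w)))
  refine ⟨(e.symm (R.orthogonalProjectionOnto (grad w))).2, fun q hq => ?_⟩
  have horth := R.starProjection_inner_eq_zero (grad w) _ ⟨⟨q, hq⟩, rfl⟩
  rw [Submodule.starProjection_apply, ← hgrad] at horth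
  rw [grad_sub, ← neg_sub, inner_neg_left, neg_eq_zero]
  exact horth

theorem exists_spaceProj_eq_clm (hd : 0 < d) (hΩo : IsOpen Ω) (hΩb : Bornology.IsBounded Ω)
    (M : ℕ) : ∃ A : H01 Ω →L[ℝ] H01 Ω, ∀ w, spaceProj M w = A w := by
  obtain ⟨A, hA⟩ := exists_isSpaceProj_clm hd hΩo hΩb M
  exact ⟨A, fun w => (Classical.epsilon_spec ⟨_, hA w⟩ : IsSpaceProj M w (spaceProj M w)).unique
    hd hΩo hΩb (hA w)⟩

theorem isSpaceProj_spaceProj (hd : 0 < d) (hΩo : IsOpen Ω) (hΩb : Bornology.IsBounded Ω)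
    (M : ℕ) (w : H01 Ω) : IsSpaceProj M w (spaceProj M w) :=
  (exists_isSpaceProj_clm hd hΩo hΩb M).elim fun _ hA => Classical.epsilon_spec ⟨_, hA w⟩

theorem IsLaplacian.unique (hΩo : IsOpen Ω) (hΩb : Bornology.IsBounded Ω) {w : H01 Ω}
    {g g' : L2 Ω} (h : IsLaplacian w g) (h' : IsLaplacian w g') : g = g' := by
  refine sub_eq_zero.1 (Lp_eq_zero_of_integral_smul hΩo _ fun ψ hψ hc hs => ?_)
  obtain ⟨φ, hφ, -⟩ := exists_toL2_ae_eq_of_hasCompactSupport hΩo hΩb hψ hc hs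
  have hinner : inner ℝ (g - g') (toL2 φ) = (0 : ℝ) := by
    rw [inner_sub_left, h φ, h' φ, sub_self]
  rw [← hinner, L2.inner_def]
  exact integral_congr_ae (hφ.mono fun x hx => by simp [hx])

theorem exists_isLaplacian (hΩo : IsOpen Ω) (hΩb : Bornology.IsBounded Ω) {w : H01 Ω}
    {φ : EuclideanSpace ℝ (Fin d) → ℝ} (hφ : ContDiff ℝ 2 φ)
    (hw : toL2 w =ᵐ[volume.restrict Ω] φ) : ∃ g, IsLaplacian w g := by
  let b := EuclideanSpace.basisFun (Fin d) ℝ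
  have hpart (i) : ContDiff ℝ 1 fun x => fderiv ℝ φ x (b i) :=
    (hφ.fderiv_right (m := 1) le_rfl).clm_apply contDiff_const
  have hΔ (i) := continuous_fderiv_apply_const (hpart i) (b i)
  have hL2 := memLp_of_continuous hΩo hΩb (continuous_finsetSum Finset.univ fun i _ => hΔ i) 2
  refine ⟨hL2.toLp _, fun v => ?_⟩
  have hgrad := grad_ae_eq_gradient hΩo hΩb (hφ.of_le one_le_two) hw
  have hintΔ (i) : Integrable (fun x => fderiv ℝ (fun y => fderiv ℝ φ y (b i)) x (b i) * toL2 v x)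
      (volume.restrict Ω) := integrable_continuous_smul hΩo hΩb (hΔ i) (Lp.memLp (toL2 v))
  have hint (i) : Integrable (fun x => fderiv ℝ φ x (b i) * inner ℝ (b i) (grad v x))
      (volume.restrict Ω) := integrable_continuous_smul hΩo hΩb (hpart i).continuous
    ((innerSL ℝ (b i)).comp_memLp' (Lp.memLp (grad v)))
  calc inner ℝ (hL2.toLp _) (toL2 v)
      = ∑ i, ∫ x in Ω, fderiv ℝ (fun y => fderiv ℝ φ y (b i)) x (b i) * toL2 v x := by
        rw [inner_toLp, ← integral_finsetSum _ fun i _ => hintΔ i]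
        simp only [RCLike.inner_apply, conj_trivial, mul_comm (toL2 v _), Finset.sum_mul]
    _ = -∑ i, ∫ x in Ω, fderiv ℝ φ x (b i) * inner ℝ (b i) (grad v x) := by
        rw [← Finset.sum_neg_distrib]
        exact Finset.sum_congr rfl fun i _ => integral_fderiv_mul_toL2 hΩo hΩb v (hpart i) (b i)
    _ = -inner ℝ (grad w) (grad v) := by
        rw [L2.inner_def, ← integral_finsetSum _ fun i _ => hint i]
        congr 1
        refine integral_congr_ae (hgrad.mono fun x hx => ?_)
        simp only [hx]
        rw [← b.sum_inner_mul_inner]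
        simp only [inner_gradient_left]

theorem isLaplacian_laplacian (hΩo : IsOpen Ω) (hΩb : Bornology.IsBounded Ω) {w : H01 Ω}
    (hw : w ∈ polySpace Ω M) : IsLaplacian w (laplacian w) := by
  obtain ⟨p, -, -, hp⟩ := hw
  exact Classical.epsilon_spec (exists_isLaplacian hΩo hΩb (contDiff_eval p 2) hp)

theorem exists_laplacian_eq_clm (hΩo : IsOpen Ω) (hΩb : Bornology.IsBounded Ω) (M : ℕ) :
    ∃ A : polySubmodule Ω M →L[ℝ] L2 Ω, ∀ w : polySubmodule Ω M, laplacian (w : H01 Ω) = A w := by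
  have := finiteDimensional_polySubmodule hΩo hΩb M
  have hlap (w : polySubmodule Ω M) := isLaplacian_laplacian hΩo hΩb w.2
  let A : polySubmodule Ω M →ₗ[ℝ] L2 Ω :=
    { toFun := fun w => laplacian (w : H01 Ω)
      map_add' := fun v w => (hlap (v + w)).unique hΩo hΩb fun φ => by
        rw [Submodule.coe_add, grad_add, inner_add_left, inner_add_left, hlap v φ, hlap w φ,
          neg_add]
      map_smul' := fun c w => (hlap (c • w)).unique hΩo hΩb fun φ => by
        rw [RingHom.id_apply, Submodule.coe_smul, grad_smul, real_inner_smul_left,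
          real_inner_smul_left, hlap w φ, mul_neg] }
  exact ⟨A.toContinuousLinearMap, fun w => rfl⟩

end PolySpace

/-! ### The nonlinear term and derivatives in time -/

section Nonlinear

variable {d : ℕ} {Ω : Set (EuclideanSpace ℝ (Fin d))}

theorem exists_nemytskii (hΩo : IsOpen Ω) (hΩb : Bornology.IsBounded Ω) {g : ℝ → ℝ}
    {L : NNReal} (hg : LipschitzWith L g) :
    ∃ G : L2 Ω → L2 Ω, LipschitzWith L G ∧ ∀ v, G v =ᵐ[volume.restrict Ω] fun x => g (v x) := by
  have hg₀ : LipschitzWith L fun y => g y - g 0 := .of_dist_le_mul fun x y => by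
    simpa only [dist_sub_right] using hg.dist_le_mul x y
  have hconst := memLp_of_continuous hΩo hΩb (continuous_const (y := g 0)) 2
  refine ⟨fun v => hg₀.compLp (sub_self _) v + hconst.toLp _, .of_dist_le_mul fun v w => ?_,
    fun v => ?_⟩
  · rw [dist_add_right]
    exact (hg₀.lipschitzWith_compLp (sub_self _)).dist_le_mul v w
  · filter_upwards [Lp.coeFn_add (hg₀.compLp (sub_self _) v) (hconst.toLp _),
      hg₀.coeFn_compLp (sub_self _) v, hconst.coeFn_toLp] with x hadd hcomp hc
    rw [hadd, Pi.add_apply, hcomp, hc, Function.comp_apply, sub_add_cancel]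

theorem nonlinPair_eq_inner {g : ℝ → ℝ} {G : L2 Ω → L2 Ω}
    (hG : ∀ v, G v =ᵐ[volume.restrict Ω] fun x => g (v x)) (w v : H01 Ω) :
    nonlinPair g w v = inner ℝ (G (toL2 w)) (toL2 v) := by
  rw [nonlinPair, L2.inner_def]
  refine integral_congr_ae ((hG (toL2 w)).mono fun x hx => ?_)
  simp only [hx, RCLike.inner_apply, conj_trivial, mul_comm]

theorem nonlinPair_eq_inner_add {f : ℝ → ℝ} {S : ℝ} {G : L2 Ω → L2 Ω}
    (hG : ∀ v, G v =ᵐ[volume.restrict Ω] fun x => f (v x) - S * v x) (w v : H01 Ω) :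
    nonlinPair f w v = inner ℝ (G (toL2 w)) (toL2 v) + S * inner ℝ (toL2 w) (toL2 v) := by
  have hF (z : L2 Ω) : (G z + S • z : L2 Ω) =ᵐ[volume.restrict Ω] fun x => f (z x) := by
    filter_upwards [Lp.coeFn_add (G z) (S • z), hG z, Lp.coeFn_smul S z] with x hadd hz hsmul
    rw [hadd, Pi.add_apply, hz, hsmul, Pi.smul_apply, smul_eq_mul, sub_add_cancel]
  rw [nonlinPair_eq_inner (G := fun z => G z + S • z) hF, inner_add_left, real_inner_smul_left]

theorem lipschitzWith_sub_mul {f : ℝ → ℝ} (hf : Differentiable ℝ f) {L S : ℝ}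
    (hfL : ∀ y, |deriv f y - S| ≤ L) : LipschitzWith L.toNNReal fun y => f y - S * y := by
  have hderiv (y : ℝ) : HasDerivAt (fun y => f y - S * y) (deriv f y - S) y := by
    simpa only [mul_one, id] using (hf y).hasDerivAt.fun_sub ((hasDerivAt_id y).const_mul S)
  refine lipschitzWith_of_nnnorm_deriv_le (fun y => (hderiv y).differentiableAt) fun y => ?_
  rw [(hderiv y).deriv, ← norm_toNNReal]
  exact Real.toNNReal_le_toNNReal (hfL y)

end Nonlinear

section TimeDeriv

variable {V : Type*} [NormedAddCommGroup V] [NormedSpace ℝ V] {a b : ℝ} {u u' w : ℝ → V}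

theorem C1On.hasTimeDeriv [CompleteSpace V] (hu : C1On a b u u') : HasTimeDeriv a b u u' := by
  obtain ⟨C, hC⟩ := isCompact_Icc.exists_bound_of_continuousOn hu.continuousOn_deriv
  refine ⟨.of_bound (hu.continuousOn_deriv.aestronglyMeasurable measurableSet_Icc) C
    (ae_restrict_of_forall_mem measurableSet_Icc hC), fun t ht => ?_⟩
  rw [(hu.mono le_rfl ht.2).integral_eq_sub ht.1, add_sub_cancel]

theorem HasTimeDeriv.ae_eq [CompleteSpace V] (hw : HasTimeDeriv a b u w) (hu : C1On a b u u')
    (hab : a ≤ b) : ∀ᵐ t, t ∈ Ioc a b → w t = u' t := by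
  have hint : IntervalIntegrable w volume a b :=
    (intervalIntegrable_iff_integrableOn_Icc_of_le hab).2 (hw.1.integrable one_le_two)
  filter_upwards [hint.ae_hasDerivAt_integral, Measure.ae_ne volume b] with t ht htb hmem
  have htI : t ∈ Ioo a b := ⟨hmem.1, lt_of_le_of_ne hmem.2 htb⟩
  have hprim : u =ᶠ[nhds t] fun x => u a + ∫ s in a..x, w s :=
    Filter.mem_of_superset (Icc_mem_nhds htI.1 htI.2) hw.2
  have hderiv := (ht (Ioc_subset_Icc_self.trans Icc_subset_uIcc hmem) a left_mem_uIcc).const_add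
    (u a)
  exact (hderiv.congr_of_eventuallyEq hprim).unique (hu.hasDerivAt t htI)

theorem C1On.of_contDiffOn (hab : a < b) (hu : ContDiffOn ℝ 1 u (Icc a b)) :
    C1On a b u (derivWithin u (Icc a b)) :=
  ⟨fun t ht => ((hu.differentiableOn one_ne_zero) t
      (Ioo_subset_Icc_self ht)).hasDerivWithinAt.hasDerivAt (Icc_mem_nhds ht.1 ht.2),
    hu.continuousOn, hu.continuousOn_derivWithin (uniqueDiffOn_Icc hab) le_rfl⟩

theorem taylorWithinEval_mem_timePoly (u : ℝ → V) (n : ℕ) (s : Set ℝ) (x₀ : ℝ) :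
    taylorWithinEval u n s x₀ ∈ timePoly n (univ : Set V) := by
  have hdeg (k : ℕ) (hk : k ∈ Finset.range (n + 1)) :
      (C ((k.factorial : ℝ)⁻¹) * (X - C x₀) ^ k : ℝ[X]).natDegree ≤ n :=
    (natDegree_C_mul_le _ _).trans <| (natDegree_pow_le_of_le k (natDegree_X_sub_C_le x₀)).trans <|
      by simpa only [mul_one] using Finset.mem_range_succ_iff.1 hk
  have heq : taylorWithinEval u n s x₀ = fun t => ∑ k ∈ Finset.range (n + 1),
      (C ((k.factorial : ℝ)⁻¹) * (X - C x₀) ^ k : ℝ[X]).eval t • iteratedDerivWithin k u s x₀ := by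
    funext t
    simp [taylor_within_apply]
  rw [heq, ← Submodule.top_coe (R := ℝ)]
  exact sum_eval_smul_mem_timePoly _ hdeg fun _ => Submodule.mem_top

end TimeDeriv

/-! ### Energy estimate on one time interval -/

section Estimates

variable {H : Type*} [NormedAddCommGroup H] [InnerProductSpace ℝ H] {a b : ℝ} {u u' : ℝ → H}

theorem norm_integral_sq_le [CompleteSpace H] (hab : a ≤ b) {F : ℝ → H}
    (hF : ContinuousOn F (Icc a b)) :
    ‖∫ t in a..b, F t‖ ^ 2 ≤ (b - a) * ∫ t in a..b, ‖F t‖ ^ 2 := by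
  rcases hab.eq_or_lt with rfl | hlt
  · simp
  have hpos : 0 < b - a := sub_pos.2 hlt
  rw [← uIcc_of_le hab] at hF
  set y := ∫ t in a..b, F t
  have hint : ∫ t in a..b, inner ℝ (F t) y = ‖y‖ ^ 2 := by
    rw [← real_inner_self_eq_norm_sq]
    simpa only [innerSL_apply_apply, real_inner_comm] using
      (innerSL ℝ y).intervalIntegral_comp_comm (μ := volume) hF.intervalIntegrable
  have hexpand : ∫ t in a..b, ‖(b - a) • F t - y‖ ^ 2 =
      (b - a) ^ 2 * (∫ t in a..b, ‖F t‖ ^ 2) - (b - a) * ‖y‖ ^ 2 := by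
    have hsq : IntervalIntegrable (fun t => (b - a) ^ 2 * ‖F t‖ ^ 2) volume a b :=
      ((hF.norm.pow 2).intervalIntegrable).const_mul _
    have hinner : IntervalIntegrable (fun t => 2 * ((b - a) * inner ℝ (F t) y)) volume a b :=
      (((hF.inner continuousOn_const).intervalIntegrable).const_mul _).const_mul _
    simp only [norm_sub_sq_real, norm_smul, mul_pow, Real.norm_eq_abs, sq_abs,
      real_inner_smul_left]
    rw [intervalIntegral.integral_add (hsq.sub hinner) intervalIntegrable_const,
      intervalIntegral.integral_sub hsq hinner, intervalIntegral.integral_const,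
      intervalIntegral.integral_const_mul, intervalIntegral.integral_const_mul,
      intervalIntegral.integral_const_mul, hint, smul_eq_mul]
    ring
  have hnonneg : 0 ≤ ∫ t in a..b, ‖(b - a) • F t - y‖ ^ 2 :=
    intervalIntegral.integral_nonneg hab fun t _ => sq_nonneg _
  rw [hexpand] at hnonneg
  nlinarith

theorem C1On.norm_sub_sq_le [CompleteSpace H] (hu : C1On a b u u') {t : ℝ}
    (ht : t ∈ Icc a b) : ‖u t - u a‖ ^ 2 ≤ (b - a) * ∫ s in a..b, ‖u' s‖ ^ 2 := by
  have hab := ht.1.trans ht.2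
  have hut := hu.mono le_rfl ht.2
  have hint : IntervalIntegrable (fun s => ‖u' s‖ ^ 2) volume a b :=
    ContinuousOn.intervalIntegrable_of_Icc hab (hu.continuousOn_deriv.norm.pow 2)
  calc ‖u t - u a‖ ^ 2
      = ‖∫ s in a..t, u' s‖ ^ 2 := by rw [hut.integral_eq_sub ht.1]
    _ ≤ (t - a) * ∫ s in a..t, ‖u' s‖ ^ 2 := norm_integral_sq_le ht.1 hut.continuousOn_deriv
    _ ≤ (b - a) * ∫ s in a..b, ‖u' s‖ ^ 2 := by
      refine mul_le_mul (sub_le_sub_right ht.2 a)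
        (intervalIntegral.integral_mono_interval le_rfl ht.1 ht.2 (.of_forall fun s => sq_nonneg _)
          hint) (intervalIntegral.integral_nonneg ht.1 fun s _ => sq_nonneg _) (sub_nonneg.2 hab)

theorem C1On.integral_inner_eq (hu : C1On a b u u') (hab : a ≤ b) :
    ∫ t in a..b, inner ℝ (u t) (u' t) = (‖u b‖ ^ 2 - ‖u a‖ ^ 2) / 2 := by
  have hsq : C1On a b (fun t => ‖u t‖ ^ 2) fun t => 2 * inner ℝ (u t) (u' t) :=
    ⟨fun t ht => (hu.hasDerivAt t ht).norm_sq, hu.continuousOn.norm.pow 2,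
      continuousOn_const.mul (hu.continuousOn.inner hu.continuousOn_deriv)⟩
  have hftc := hsq.integral_eq_sub hab
  rw [intervalIntegral.integral_const_mul] at hftc
  linarith

theorem neg_inner_add_inner_sub_inner_le {ε L : ℝ} (hε : 0 < ε) (r A Λ G : H) {D : ℝ}
    (hG : ‖G‖ ≤ L * D) :
    -inner ℝ A r + ε * inner ℝ Λ r - 1 / ε * inner ℝ G r ≤
      1 / 4 * ‖r‖ ^ 2 + 6 * ‖A‖ ^ 2 + 6 * ε ^ 2 * ‖Λ‖ ^ 2 + 3 / 2 * (L / ε) ^ 2 * D ^ 2 := by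
  have hA : -inner ℝ A r ≤ ‖A‖ * ‖r‖ := (neg_le_abs _).trans (abs_real_inner_le_norm A r)
  have hΛ : ε * inner ℝ Λ r ≤ ε * ‖Λ‖ * ‖r‖ := by
    simpa only [mul_assoc] using mul_le_mul_of_nonneg_left (real_inner_le_norm Λ r) hε.le
  have hGr : -(1 / ε * inner ℝ G r) ≤ L / ε * D * ‖r‖ :=
    calc -(1 / ε * inner ℝ G r)
        ≤ 1 / ε * (‖G‖ * ‖r‖) := by
          rw [← mul_neg]
          gcongr
          exact (neg_le_abs _).trans (abs_real_inner_le_norm G r)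
      _ ≤ 1 / ε * (L * D * ‖r‖) := by gcongr
      _ = L / ε * D * ‖r‖ := by ring
  -- `xy ≤ 6x² + y²/24` for the first two terms and `xy ≤ 3x²/2 + y²/6` for the last one
  nlinarith [sq_nonneg (12 * ‖A‖ - ‖r‖), sq_nonneg (12 * (ε * ‖Λ‖) - ‖r‖),
    sq_nonneg (3 * (L / ε * D) - ‖r‖)]

theorem integral_norm_sq_add_le_of_integral_eq {ε L : ℝ} (hab : a ≤ b) (hε : 0 < ε)
    {r A Λ Γ : ℝ → H} {E D : ℝ → ℝ} (hr : ContinuousOn r (Icc a b))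
    (hA : ContinuousOn A (Icc a b)) (hΛ : ContinuousOn Λ (Icc a b))
    (hΓ : ContinuousOn Γ (Icc a b)) (hE : ContinuousOn E (Icc a b))
    (hD : ContinuousOn D (Icc a b)) (hΓD : ∀ t ∈ Icc a b, ‖Γ t‖ ≤ L * D t)
    (heq : ∫ t in a..b, (‖r t‖ ^ 2 + E t) =
      ∫ t in a..b, (-inner ℝ (A t) (r t) + ε * inner ℝ (Λ t) (r t)
        - 1 / ε * inner ℝ (Γ t) (r t))) :
    3 / 4 * (∫ t in a..b, ‖r t‖ ^ 2) + ∫ t in a..b, E t ≤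
      6 * (∫ t in a..b, ‖A t‖ ^ 2) + 6 * ε ^ 2 * (∫ t in a..b, ‖Λ t‖ ^ 2)
        + 3 / 2 * (L / ε) ^ 2 * ∫ t in a..b, D t ^ 2 := by
  have hint {g : ℝ → ℝ} (hg : ContinuousOn g (Icc a b)) : IntervalIntegrable g volume a b :=
    hg.intervalIntegrable_of_Icc hab
  have hr2 := hint (g := fun t => ‖r t‖ ^ 2) (hr.norm.pow 2)
  have hA2 := hint (g := fun t => ‖A t‖ ^ 2) (hA.norm.pow 2)
  have hΛ2 := hint (g := fun t => ‖Λ t‖ ^ 2) (hΛ.norm.pow 2)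
  have hD2 := hint (g := fun t => D t ^ 2) (hD.pow 2)
  have hmono := intervalIntegral.integral_mono_on hab
    (hint (by fun_prop : ContinuousOn (fun t => -inner ℝ (A t) (r t) + ε * inner ℝ (Λ t) (r t)
      - 1 / ε * inner ℝ (Γ t) (r t)) (Icc a b)))
    ((((hr2.const_mul (1 / 4)).add (hA2.const_mul 6)).add (hΛ2.const_mul (6 * ε ^ 2))).add
      (hD2.const_mul (3 / 2 * (L / ε) ^ 2)))
    fun t ht => neg_inner_add_inner_sub_inner_le hε (r t) (A t) (Λ t) (Γ t) (hΓD t ht)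
  rw [← heq, intervalIntegral.integral_add hr2 (hint hE),
    intervalIntegral.integral_add
      (((hr2.const_mul _).add (hA2.const_mul _)).add (hΛ2.const_mul _)) (hD2.const_mul _),
    intervalIntegral.integral_add ((hr2.const_mul _).add (hA2.const_mul _)) (hΛ2.const_mul _),
    intervalIntegral.integral_add (hr2.const_mul _) (hA2.const_mul _)] at hmono
  simp only [intervalIntegral.integral_const_mul] at hmono
  linarith

end Estimates

section Energy

variable {d : ℕ} {Ω : Set (EuclideanSpace ℝ (Fin d))} {M m k : ℕ} {τ : ℝ} {u u' : ℝ → H01 Ω}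

theorem C1On.toL2 {a b : ℝ} (hu : C1On a b u u') :
    C1On a b (fun t => toL2 (u t)) fun t => toL2 (u' t) :=
  hu.map toL2L

theorem C1On.grad {a b : ℝ} (hu : C1On a b u u') :
    C1On a b (fun t => grad (u t)) fun t => grad (u' t) :=
  hu.map gradL

theorem fullProj_eq_spaceProj_timeProj (hd : 0 < d) (hΩo : IsOpen Ω)
    (hΩb : Bornology.IsBounded Ω) (M m : ℕ) (hk : node τ (k - 1) < node τ k)
    (hu : C1On (node τ (k - 1)) (node τ k) u u') (t : ℝ) :
    fullProj M (m + 1) τ k u t =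
      spaceProj M (timeProj (m + 1) (node τ (k - 1)) (node τ k) u t) := by
  obtain ⟨A, hA⟩ := exists_spaceProj_eq_clm hd hΩo hΩb M
  simp only [fullProj, hA]
  exact timeProj_map A hk hu m t

theorem fullProj_mem_discreteSpace (hd : 0 < d) (hΩo : IsOpen Ω) (hΩb : Bornology.IsBounded Ω)
    (M m : ℕ) (hk : node τ (k - 1) < node τ k) (hu : C1On (node τ (k - 1)) (node τ k) u u') :
    fullProj M (m + 1) τ k u ∈ discreteSpace Ω M (m + 1) := by
  obtain ⟨A, hA⟩ := exists_spaceProj_eq_clm hd hΩo hΩb M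
  have hmem (w : H01 Ω) : A w ∈ polySpace Ω M :=
    hA w ▸ (isSpaceProj_spaceProj hd hΩo hΩb M w).1
  rw [funext (fullProj_eq_spaceProj_timeProj hd hΩo hΩb M m hk hu), funext fun t => hA _]
  exact map_mem_timePoly A.toLinearMap (fun w _ => hmem w) (timeProj_mem_timePoly hk hu m)

theorem fullProj_left (hd : 0 < d) (hΩo : IsOpen Ω) (hΩb : Bornology.IsBounded Ω)
    (M m : ℕ) (hk : node τ (k - 1) < node τ k) (hu : C1On (node τ (k - 1)) (node τ k) u u') :
    fullProj M (m + 1) τ k u (node τ (k - 1)) = spaceProj M (u (node τ (k - 1))) := by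
  rw [fullProj_eq_spaceProj_timeProj hd hΩo hΩb M m hk hu, timeProj_left hk hu m]

theorem fullProj_right (hd : 0 < d) (hΩo : IsOpen Ω) (hΩb : Bornology.IsBounded Ω)
    (M m : ℕ) (hk : node τ (k - 1) < node τ k) (hu : C1On (node τ (k - 1)) (node τ k) u u') :
    fullProj M (m + 1) τ k u (node τ k) = spaceProj M (u (node τ k)) := by
  rw [fullProj_eq_spaceProj_timeProj hd hΩo hΩb M m hk hu, timeProj_right hk hu m]

theorem rho_mem_discreteSpace (hd : 0 < d) (hΩo : IsOpen Ω) (hΩb : Bornology.IsBounded Ω)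
    (hk : node τ (k - 1) < node τ k) (hu : C1On (node τ (k - 1)) (node τ k) u u')
    {h : ℕ → ℝ → H01 Ω} (hh : h k ∈ discreteSpace Ω M (m + 1)) :
    rho M (m + 1) τ u h k ∈ discreteSpace Ω M (m + 1) :=
  sub_mem_timePoly (Y := polySubmodule Ω M) hh (fullProj_mem_discreteSpace hd hΩo hΩb M m hk hu)

theorem deriv_projErrSpace (hd : 0 < d) (hΩo : IsOpen Ω) (hΩb : Bornology.IsBounded Ω)
    (M m : ℕ) (hk : node τ (k - 1) < node τ k) (hu : C1On (node τ (k - 1)) (node τ k) u u') :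
    deriv (projErrSpace M (m + 1) τ k u) =
      deriv (fullProj M (m + 1) τ k u) -
        deriv (timeProj (m + 1) (node τ (k - 1)) (node τ k) u) := by
  have heq : projErrSpace M (m + 1) τ k u =
      fullProj M (m + 1) τ k u - timeProj (m + 1) (node τ (k - 1)) (node τ k) u :=
    funext fun t =>
      congrArg (· - _) (fullProj_eq_spaceProj_timeProj hd hΩo hΩb M m hk hu t).symm
  rw [heq]
  exact funext fun t => deriv_sub
    (differentiable_of_mem_timePoly (fullProj_mem_discreteSpace hd hΩo hΩb M m hk hu) t)
    (differentiable_of_mem_timePoly (timeProj_mem_timePoly hk hu m) t)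

theorem continuous_deriv_projErrSpace (hd : 0 < d) (hΩo : IsOpen Ω)
    (hΩb : Bornology.IsBounded Ω) (M m : ℕ) (hk : node τ (k - 1) < node τ k)
    (hu : C1On (node τ (k - 1)) (node τ k) u u') :
    Continuous (deriv (projErrSpace M (m + 1) τ k u)) := by
  rw [deriv_projErrSpace hd hΩo hΩb M m hk hu]
  exact (continuous_of_mem_timePoly (deriv_mem_timePoly_univ
    (fullProj_mem_discreteSpace hd hΩo hΩb M m hk hu))).sub
    (continuous_of_mem_timePoly (deriv_mem_timePoly_univ (timeProj_mem_timePoly hk hu m)))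

theorem continuousOn_projErr (hd : 0 < d) (hΩo : IsOpen Ω) (hΩb : Bornology.IsBounded Ω)
    (M m : ℕ) (hk : node τ (k - 1) < node τ k) (hu : C1On (node τ (k - 1)) (node τ k) u u') :
    ContinuousOn (projErr M (m + 1) τ k u) (Icc (node τ (k - 1)) (node τ k)) :=
  (continuous_of_mem_timePoly
    (fullProj_mem_discreteSpace hd hΩo hΩb M m hk hu)).continuousOn.sub hu.continuousOn

theorem continuousOn_laplacian_projErrTime (hd : 0 < d) (hΩo : IsOpen Ω)
    (hΩb : Bornology.IsBounded Ω) (M m : ℕ) (hk : node τ (k - 1) < node τ k)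
    (hu : C1On (node τ (k - 1)) (node τ k) u u') :
    ContinuousOn (fun t => laplacian (projErrTime M (m + 1) τ k u t))
      (Icc (node τ (k - 1)) (node τ k)) := by
  obtain ⟨A, hA⟩ := exists_spaceProj_eq_clm hd hΩo hΩb M
  obtain ⟨Δ, hΔ⟩ := exists_laplacian_eq_clm hΩo hΩb M
  have hP := fullProj_mem_discreteSpace hd hΩo hΩb M m hk hu
  have hmem (t : ℝ) : projErrTime M (m + 1) τ k u t ∈ polySubmodule Ω M :=
    (polySubmodule Ω M).sub_mem (mem_of_mem_timePoly (Y := polySubmodule Ω M) hP t)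
      (isSpaceProj_spaceProj hd hΩo hΩb M (u t)).1
  have hcont : ContinuousOn (projErrTime M (m + 1) τ k u) (Icc (node τ (k - 1)) (node τ k)) := by
    refine (continuous_of_mem_timePoly hP).continuousOn.sub ?_
    simp only [hA]
    exact A.continuous.comp_continuousOn hu.continuousOn
  rw [funext fun t => hΔ ⟨_, hmem t⟩]
  exact Δ.continuous.comp_continuousOn
    (Topology.IsInducing.subtypeVal.continuousOn_iff.2 hcont)

theorem IsSemiImplicitStep.integral_eq_zero {f : ℝ → ℝ} {ε S a b : ℝ} {g h v : ℝ → H01 Ω}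
    (hstep : IsSemiImplicitStep f ε S M (m + 1) a b g h) {G : L2 Ω → L2 Ω}
    (hG : ∀ w, G w =ᵐ[volume.restrict Ω] fun x => f (w x) - S * w x)
    (hv : v ∈ discreteSpace Ω M (m + 1)) :
    ∫ t in a..b, (inner ℝ (toL2 (deriv h t)) (toL2 (deriv v t))
      + ε * inner ℝ (grad (h t)) (grad (deriv v t))
      + S / ε * inner ℝ (toL2 (h t)) (toL2 (deriv v t))
      + 1 / ε * inner ℝ (G (toL2 (g t))) (toL2 (deriv v t))) = 0 := by
  obtain ⟨hh, hha, htest⟩ := hstep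
  have hconst : h a - v a ∈ polySubmodule Ω M :=
    (polySubmodule Ω M).sub_mem (mem_of_mem_timePoly (Y := polySubmodule Ω M) hh a)
      (mem_of_mem_timePoly (Y := polySubmodule Ω M) hv a)
  have hzero := htest (v + fun _ => h a - v a)
    (add_mem_timePoly (Y := polySubmodule Ω M) hv (const_mem_timePoly (m + 1) hconst))
    (by simp [hha])
  have hderiv : deriv (v + fun _ => h a - v a) = deriv v :=
    funext fun t => deriv_add_const _
  simpa only [hderiv, nonlinPair_eq_inner (g := fun y => f y - S * y) hG] using hzero

theorem IsWeakSolution.integral_eq_zero {f : ℝ → ℝ} {ε S a b : ℝ} {v v' : ℝ → H01 Ω}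
    (hsol : IsWeakSolution f ε a b u) (hab : a ≤ b) (hu : C1On a b u u') {G : L2 Ω → L2 Ω}
    (hG : ∀ w, G w =ᵐ[volume.restrict Ω] fun x => f (w x) - S * w x) (hv : C1On a b v v') :
    ∫ t in a..b, (inner ℝ (toL2 (u' t)) (toL2 (v' t))
      + ε * inner ℝ (grad (u t)) (grad (v' t))
      + 1 / ε * (inner ℝ (G (toL2 (u t))) (toL2 (v' t))
        + S * inner ℝ (toL2 (u t)) (toL2 (v' t)))) = 0 := by
  obtain ⟨w, hw, htest⟩ := hsol
  have hshift : C1On a b (fun t => v t + (u a - v a)) v' :=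
    ⟨fun t ht => (hv.hasDerivAt t ht).add_const _, hv.continuousOn.add continuousOn_const,
      hv.continuousOn_deriv⟩
  rw [← htest _ _ hshift.hasTimeDeriv (add_sub_cancel _ _)]
  refine intervalIntegral.integral_congr_ae ?_
  rw [uIoc_of_le hab]
  filter_upwards [hw.ae_eq hu hab] with t ht hmem
  rw [ht hmem, nonlinPair_eq_inner_add hG]

/-- The elliptic projection removes `ε⟪∇(w - u), ∇r⟫`, and the Laplacian `Λ` of `P - w` puts the
remaining gradient term `ε⟪∇(P - w), ∇r⟫` into `L²`. -/
theorem error_identity {ε S : ℝ} {h h' u u' P P' Q' w ρ ρ' : H01 Ω} {Λ Gg Gu : L2 Ω}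
    (hρ : ρ = h - P) (hρ' : ρ' = h' - P')
    (hlap : inner ℝ Λ (toL2 ρ') = -inner ℝ (grad (P - w)) (grad ρ'))
    (hell : inner ℝ (grad (w - u)) (grad ρ') = (0 : ℝ)) :
    ‖toL2 ρ'‖ ^ 2
        + (ε * inner ℝ (grad ρ) (grad ρ') + S / ε * inner ℝ (toL2 ρ) (toL2 ρ')) =
      (-inner ℝ (toL2 (P' - Q') + (S / ε) • toL2 (P - u)) (toL2 ρ')
        + ε * inner ℝ Λ (toL2 ρ') - 1 / ε * inner ℝ (Gg - Gu) (toL2 ρ'))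
      + ((inner ℝ (toL2 h') (toL2 ρ') + ε * inner ℝ (grad h) (grad ρ')
            + S / ε * inner ℝ (toL2 h) (toL2 ρ') + 1 / ε * inner ℝ Gg (toL2 ρ'))
          - (inner ℝ (toL2 u') (toL2 ρ') + ε * inner ℝ (grad u) (grad ρ')
            + 1 / ε * (inner ℝ Gu (toL2 ρ') + S * inner ℝ (toL2 u) (toL2 ρ')))
          - inner ℝ (toL2 Q' - toL2 u') (toL2 ρ')) := by
  obtain rfl : h' = ρ' + P' := by rw [hρ', sub_add_cancel]
  rw [hρ, hlap, ← real_inner_self_eq_norm_sq]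
  simp only [toL2_add, toL2_sub, grad_sub, inner_add_left, inner_sub_left,
    real_inner_smul_left] at hell ⊢
  linear_combination (-ε) * hell

theorem integral_inner_deriv_timeProj_sub {V H : Type*} [NormedAddCommGroup V] [NormedSpace ℝ V]
    [CompleteSpace V] [NormedAddCommGroup H] [InnerProductSpace ℝ H] [CompleteSpace H] {a b : ℝ}
    {w w' : ℝ → V} (A : V →L[ℝ] H) (hab : a < b) (hw : C1On a b w w') {Y : Set H} {r : ℝ → H}
    (hr : r ∈ timePoly m Y) :
    ∫ t in a..b, inner ℝ (A (deriv (timeProj (m + 1) a b w) t) - A (w' t)) (r t) = 0 := by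
  simp only [deriv_timeProj hab hw m, ← legendreProj_map A (hw.intervalIntegrable_deriv hab.le)]
  exact integral_inner_legendreProj_sub hab ((hw.map A).intervalIntegrable_deriv hab.le) hr

theorem rho_identity (hd : 0 < d) (hΩo : IsOpen Ω) (hΩb : Bornology.IsBounded Ω)
    (hk : node τ (k - 1) < node τ k) (hu : C1On (node τ (k - 1)) (node τ k) u u')
    {h : ℕ → ℝ → H01 Ω} (hh : h k ∈ discreteSpace Ω M (m + 1)) {ρ : ℝ → H01 Ω}
    (hρ : ρ = rho M (m + 1) τ u h k) (ε S : ℝ) (Gg Gu : L2 Ω) (v' : H01 Ω) (t : ℝ) :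
    ‖toL2 (deriv ρ t)‖ ^ 2 + (ε * inner ℝ (grad (ρ t)) (grad (deriv ρ t))
        + S / ε * inner ℝ (toL2 (ρ t)) (toL2 (deriv ρ t))) =
      (-inner ℝ (toL2 (deriv (projErrSpace M (m + 1) τ k u) t)
            + (S / ε) • toL2 (projErr M (m + 1) τ k u t)) (toL2 (deriv ρ t))
          + ε * inner ℝ (laplacian (projErrTime M (m + 1) τ k u t)) (toL2 (deriv ρ t))
          - 1 / ε * inner ℝ (Gg - Gu) (toL2 (deriv ρ t)))
      + ((inner ℝ (toL2 (deriv (h k) t)) (toL2 (deriv ρ t))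
            + ε * inner ℝ (grad (h k t)) (grad (deriv ρ t))
            + S / ε * inner ℝ (toL2 (h k t)) (toL2 (deriv ρ t))
            + 1 / ε * inner ℝ Gg (toL2 (deriv ρ t)))
          - (inner ℝ (toL2 v') (toL2 (deriv ρ t)) + ε * inner ℝ (grad (u t)) (grad (deriv ρ t))
            + 1 / ε * (inner ℝ Gu (toL2 (deriv ρ t))
              + S * inner ℝ (toL2 (u t)) (toL2 (deriv ρ t))))
          - inner ℝ (toL2 (deriv (timeProj (m + 1) (node τ (k - 1)) (node τ k) u) t) - toL2 v')
            (toL2 (deriv ρ t))) := by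
  have hP := fullProj_mem_discreteSpace hd hΩo hΩb M m hk hu
  have hρ'mem := deriv_mem_timePoly (Y := polySubmodule Ω M)
    (hρ ▸ rho_mem_discreteSpace hd hΩo hΩb hk hu hh)
  have hproj := isSpaceProj_spaceProj hd hΩo hΩb M (u t)
  have hderiv : deriv ρ t = deriv (h k) t - deriv (fullProj M (m + 1) τ k u) t := by
    rw [hρ]
    exact deriv_sub (differentiable_of_mem_timePoly hh t) (differentiable_of_mem_timePoly hP t)
  rw [deriv_projErrSpace hd hΩo hΩb M m hk hu, Pi.sub_apply]
  exact error_identity (congrFun hρ t) hderiv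
    (isLaplacian_laplacian hΩo hΩb ((polySubmodule Ω M).sub_mem
      (mem_of_mem_timePoly (Y := polySubmodule Ω M) hP t) hproj.1) (deriv ρ t))
    (hproj.2 (deriv ρ t) (mem_of_mem_timePoly (Y := polySubmodule Ω M) hρ'mem t))

theorem integral_add_sub_sub_eq {a b : ℝ} {F F₁ F₂ F₃ : ℝ → ℝ}
    (hF : IntervalIntegrable F volume a b) (hF₁ : IntervalIntegrable F₁ volume a b)
    (hF₂ : IntervalIntegrable F₂ volume a b) (hF₃ : IntervalIntegrable F₃ volume a b)
    (h₁ : ∫ t in a..b, F₁ t = 0) (h₂ : ∫ t in a..b, F₂ t = 0) (h₃ : ∫ t in a..b, F₃ t = 0) :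
    ∫ t in a..b, (F t + (F₁ t - F₂ t - F₃ t)) = ∫ t in a..b, F t := by
  rw [intervalIntegral.integral_add hF ((hF₁.sub hF₂).sub hF₃),
    intervalIntegral.integral_sub (hF₁.sub hF₂) hF₃, intervalIntegral.integral_sub hF₁ hF₂,
    h₁, h₂, h₃]
  ring

theorem integral_error_eq (hd : 0 < d) (hΩo : IsOpen Ω) (hΩb : Bornology.IsBounded Ω)
    (hk : node τ (k - 1) < node τ k) (hu : C1On (node τ (k - 1)) (node τ k) u u') {f : ℝ → ℝ}
    {ε S : ℝ} (hsol : IsWeakSolution f ε (node τ (k - 1)) (node τ k) u) {h : ℕ → ℝ → H01 Ω}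
    (hstep : IsSemiImplicitStep f ε S M (m + 1) (node τ (k - 1)) (node τ k) (h (k - 1)) (h k))
    (hprev : Continuous (h (k - 1))) {G : L2 Ω → L2 Ω} (hGc : Continuous G)
    (hG : ∀ w, G w =ᵐ[volume.restrict Ω] fun x => f (w x) - S * w x)
    {ρ : ℝ → H01 Ω} (hρ : ρ = rho M (m + 1) τ u h k) :
    ∫ t in node τ (k - 1)..node τ k, (‖toL2 (deriv ρ t)‖ ^ 2
        + (ε * inner ℝ (grad (ρ t)) (grad (deriv ρ t))
          + S / ε * inner ℝ (toL2 (ρ t)) (toL2 (deriv ρ t)))) =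
      ∫ t in node τ (k - 1)..node τ k,
        (-inner ℝ (toL2 (deriv (projErrSpace M (m + 1) τ k u) t)
            + (S / ε) • toL2 (projErr M (m + 1) τ k u t)) (toL2 (deriv ρ t))
          + ε * inner ℝ (laplacian (projErrTime M (m + 1) τ k u t)) (toL2 (deriv ρ t))
          - 1 / ε * inner ℝ (G (toL2 (h (k - 1) t)) - G (toL2 (u t))) (toL2 (deriv ρ t))) := by
  have hρmem : ρ ∈ discreteSpace Ω M (m + 1) := hρ ▸ rho_mem_discreteSpace hd hΩo hΩb hk hu hstep.1
  have hρ'mem := deriv_mem_timePoly (Y := polySubmodule Ω M) hρmem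
  have hscheme := hstep.integral_eq_zero hG hρmem
  have hweak := hsol.integral_eq_zero hk.le hu hG (C1On.of_mem_timePoly hρmem)
  have horth := integral_inner_deriv_timeProj_sub toL2L hk hu
    (map_mem_timePoly toL2L.toLinearMap (fun _ _ => mem_univ _) hρ'mem)
  have huc := hu.continuousOn
  have hu'c := hu.continuousOn_deriv
  have hΛ := continuousOn_laplacian_projErrTime hd hΩo hΩb M m hk hu
  have hπ := continuousOn_projErr hd hΩo hΩb M m hk hu
  have hM'c := continuous_deriv_projErrSpace hd hΩo hΩb M m hk hu
  have hQ'c := continuous_of_mem_timePoly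
    (deriv_mem_timePoly_univ (timeProj_mem_timePoly hk hu m))
  have hhc := continuous_of_mem_timePoly hstep.1
  have hh'c := continuous_of_mem_timePoly (deriv_mem_timePoly_univ hstep.1)
  have hρ'c := continuous_of_mem_timePoly hρ'mem
  rw [intervalIntegral.integral_congr fun t _ => rho_identity hd hΩo hΩb hk hu hstep.1 hρ ε S
    (G (toL2 (h (k - 1) t))) (G (toL2 (u t))) (u' t) t]
  refine integral_add_sub_sub_eq ?_ ?_ ?_ ?_ hscheme hweak horth <;>
    exact ContinuousOn.intervalIntegrable_of_Icc hk.le (by fun_prop)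

theorem integral_grad_add_integral_toL2_eq {a b : ℝ} (hu : C1On a b u u') (hab : a ≤ b)
    (α β : ℝ) :
    ∫ t in a..b, (α * inner ℝ (grad (u t)) (grad (u' t))
        + β * inner ℝ (toL2 (u t)) (toL2 (u' t))) =
      α / 2 * (‖grad (u b)‖ ^ 2 - ‖grad (u a)‖ ^ 2)
        + β / 2 * (‖toL2 (u b)‖ ^ 2 - ‖toL2 (u a)‖ ^ 2) := by
  have huc := hu.continuousOn
  have hu'c := hu.continuousOn_deriv
  rw [intervalIntegral.integral_add
      (ContinuousOn.intervalIntegrable_of_Icc hab (by fun_prop))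
      (ContinuousOn.intervalIntegrable_of_Icc hab (by fun_prop)),
    intervalIntegral.integral_const_mul, intervalIntegral.integral_const_mul,
    hu.grad.integral_inner_eq hab, hu.toL2.integral_inner_eq hab]
  ring

theorem energy_estimate (hd : 0 < d) (hΩo : IsOpen Ω) (hΩb : Bornology.IsBounded Ω)
    (hk : node τ (k - 1) < node τ k) (hu : C1On (node τ (k - 1)) (node τ k) u u') {f : ℝ → ℝ}
    {ε L S : ℝ} (hε : 0 < ε) (hL : 0 ≤ L) (hf : LipschitzWith L.toNNReal fun y => f y - S * y)
    (hsol : IsWeakSolution f ε (node τ (k - 1)) (node τ k) u) {h : ℕ → ℝ → H01 Ω}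
    (hstep : IsSemiImplicitStep f ε S M (m + 1) (node τ (k - 1)) (node τ k) (h (k - 1)) (h k))
    (hprev : Continuous (h (k - 1))) {ρ : ℝ → H01 Ω} (hρ : ρ = rho M (m + 1) τ u h k) :
    3 / 4 * slabNormSq τ k (fun t => toL2 (deriv ρ t))
        + (ε / 2 * (‖grad (ρ (node τ k))‖ ^ 2 - ‖grad (ρ (node τ (k - 1)))‖ ^ 2)
          + S / ε / 2 * (‖toL2 (ρ (node τ k))‖ ^ 2 - ‖toL2 (ρ (node τ (k - 1)))‖ ^ 2)) ≤
      6 * slabNormSq τ k (fun t => toL2 (deriv (projErrSpace M (m + 1) τ k u) t)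
          + (S / ε) • toL2 (projErr M (m + 1) τ k u t))
        + 6 * ε ^ 2 * slabNormSq τ k (fun t => laplacian (projErrTime M (m + 1) τ k u t))
        + 3 / 2 * (L / ε) ^ 2 * slabNormSq τ k (fun t => toL2 (h (k - 1) t - u t)) := by
  obtain ⟨G, hGL, hG⟩ := exists_nemytskii hΩo hΩb hf
  have hGc := hGL.continuous
  have hρmem := hρ ▸ rho_mem_discreteSpace hd hΩo hΩb hk hu hstep.1
  have hρC := C1On.of_mem_timePoly hρmem (a := node τ (k - 1)) (b := node τ k)
  have hΛ := continuousOn_laplacian_projErrTime hd hΩo hΩb M m hk hu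
  have hM' := continuous_deriv_projErrSpace hd hΩo hΩb M m hk hu
  have hπ := continuousOn_projErr hd hΩo hΩb M m hk hu
  have huc := hu.continuousOn
  have hρc := hρC.continuousOn
  have hρ'c := hρC.continuousOn_deriv
  rw [← integral_grad_add_integral_toL2_eq hρC hk.le]
  refine integral_norm_sq_add_le_of_integral_eq hk.le hε (by fun_prop) (by fun_prop) hΛ
    (by fun_prop) (by fun_prop) (D := fun t => ‖toL2 (h (k - 1) t - u t)‖) (by fun_prop) ?_
    (integral_error_eq hd hΩo hΩb hk hu hsol hstep hprev hGc hG hρ)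
  intro t _
  rw [toL2_sub, ← dist_eq_norm, ← dist_eq_norm]
  simpa only [Real.coe_toNNReal L hL] using hGL.dist_le_mul (toL2 (h (k - 1) t)) (toL2 (u t))

end Energy

/-! ### The error recursion -/

section Estimates

variable {H : Type*} [NormedAddCommGroup H] [InnerProductSpace ℝ H] {a b : ℝ} {u u' : ℝ → H}

theorem integral_norm_add_sq_le {E : Type*} [NormedAddCommGroup E] (hab : a ≤ b) {v w : ℝ → E}
    (hv : ContinuousOn v (Icc a b)) (hw : ContinuousOn w (Icc a b)) :
    ∫ t in a..b, ‖v t + w t‖ ^ 2 ≤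
      2 * (∫ t in a..b, ‖v t‖ ^ 2) + 2 * ∫ t in a..b, ‖w t‖ ^ 2 := by
  have hv2 : IntervalIntegrable (fun t => 2 * ‖v t‖ ^ 2) volume a b :=
    ContinuousOn.intervalIntegrable_of_Icc hab (by fun_prop)
  have hw2 : IntervalIntegrable (fun t => 2 * ‖w t‖ ^ 2) volume a b :=
    ContinuousOn.intervalIntegrable_of_Icc hab (by fun_prop)
  rw [← intervalIntegral.integral_const_mul, ← intervalIntegral.integral_const_mul,
    ← intervalIntegral.integral_add hv2 hw2]
  refine intervalIntegral.integral_mono_on hab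
    (ContinuousOn.intervalIntegrable_of_Icc hab (by fun_prop)) (hv2.add hw2) fun t _ => ?_
  calc ‖v t + w t‖ ^ 2 ≤ (‖v t‖ + ‖w t‖) ^ 2 := by gcongr; exact norm_add_le _ _
    _ ≤ 2 * ‖v t‖ ^ 2 + 2 * ‖w t‖ ^ 2 := add_sq_le.trans_eq (mul_add _ _ _)

theorem integral_norm_sub_sq_extrapolation_le {m : ℕ} (hab : a < b) {g p q w : ℝ → H}
    (hg : g ∈ timePoly m univ) (hp : p ∈ timePoly m univ) (hq : q ∈ timePoly m univ)
    (hw : ContinuousOn w (Icc b (2 * b - a))) :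
    ∫ t in b..(2 * b - a), ‖g t - w t‖ ^ 2 ≤
      2 * (extrapConst m ^ 2 *
          (2 * (∫ t in a..b, ‖g t - q t‖ ^ 2) + 2 * ∫ t in a..b, ‖p t - q t‖ ^ 2))
        + 2 * ∫ t in b..(2 * b - a), ‖p t - w t‖ ^ 2 := by
  have hgc := continuous_of_mem_timePoly hg
  have hpc := continuous_of_mem_timePoly hp
  have hqc := continuous_of_mem_timePoly hq
  have hsplit := integral_norm_add_sq_le (by linarith : b ≤ 2 * b - a)
    (hgc.sub hpc).continuousOn (hpc.continuousOn.sub hw)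
  have hextrap := integral_norm_sq_extrapolation_le hab (sub_mem_timePoly (Y := ⊤) hg hp)
  have hprev := integral_norm_add_sq_le hab.le (hgc.sub hqc).continuousOn
    (hqc.sub hpc).continuousOn
  simp only [Pi.sub_apply, sub_add_sub_cancel] at hsplit hextrap hprev
  simp only [norm_sub_rev (q _) (p _)] at hprev
  have hbound := hextrap.trans (mul_le_mul_of_nonneg_left hprev (sq_nonneg (extrapConst m)))
  linarith

theorem norm_sq_le_of_pos {E : Type*} [NormedAddCommGroup E] {θ : ℝ} (hθ : 0 < θ) (x y : E) :
    ‖y‖ ^ 2 ≤ (1 + θ) * ‖x‖ ^ 2 + (1 + 1 / θ) * ‖y - x‖ ^ 2 := by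
  have htriangle : ‖y‖ ^ 2 ≤ (‖x‖ + ‖y - x‖) ^ 2 := by
    gcongr
    exact norm_le_norm_add_norm_sub' y x
  have hyoung : 0 ≤ θ * ‖x‖ ^ 2 - 2 * (‖x‖ * ‖y - x‖) + 1 / θ * ‖y - x‖ ^ 2 := by
    have heq : θ * ‖x‖ ^ 2 - 2 * (‖x‖ * ‖y - x‖) + 1 / θ * ‖y - x‖ ^ 2 =
        (θ * ‖x‖ - ‖y - x‖) ^ 2 / θ := by
      field_simp
      ring
    rw [heq]
    positivity
  linarith

theorem C1On.norm_sq_right_le [CompleteSpace H] (hu : C1On a b u u') (hab : a ≤ b) {θ : ℝ}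
    (hθ : 0 < θ) :
    ‖u b‖ ^ 2 ≤ (1 + θ) * ‖u a‖ ^ 2
      + (1 + 1 / θ) * ((b - a) * ∫ t in a..b, ‖u' t‖ ^ 2) := by
  refine (norm_sq_le_of_pos hθ (u a) (u b)).trans ?_
  gcongr
  exact hu.norm_sub_sq_le (right_mem_Icc.2 hab)

theorem norm_add_add_sq_le {E : Type*} [NormedAddCommGroup E] (x y z : E) :
    3 / 2 * ‖x + y + z‖ ^ 2 ≤ 4 * ‖x‖ ^ 2 + 4 * ‖y‖ ^ 2 + 6 * ‖z‖ ^ 2 := by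
  have htriangle : ‖x + y + z‖ ^ 2 ≤ (‖x‖ + ‖y‖ + ‖z‖) ^ 2 := by
    gcongr
    exact norm_add₃_le
  nlinarith [sq_nonneg (‖x‖ - ‖y‖), sq_nonneg (2 * ‖x‖ - 3 * ‖z‖),
    sq_nonneg (2 * ‖y‖ - 3 * ‖z‖)]

theorem C1On.integral_norm_sq_le [CompleteSpace H] (hu : C1On a b u u') (hab : a ≤ b) {x y : H}
    (hxy : u a = x + y) :
    3 / 2 * ∫ t in a..b, ‖u t‖ ^ 2 ≤
      (b - a) * (4 * ‖x‖ ^ 2 + 4 * ‖y‖ ^ 2 + 6 * ((b - a) * ∫ t in a..b, ‖u' t‖ ^ 2)) := by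
  have huc := hu.continuousOn
  rw [← intervalIntegral.integral_const_mul, ← smul_eq_mul (b - a),
    ← intervalIntegral.integral_const]
  refine intervalIntegral.integral_mono_on hab
    (ContinuousOn.intervalIntegrable_of_Icc hab (by fun_prop)) intervalIntegrable_const
    fun t ht => ?_
  calc 3 / 2 * ‖u t‖ ^ 2 = 3 / 2 * ‖x + y + (u t - u a)‖ ^ 2 := by rw [← hxy, add_sub_cancel]
    _ ≤ 4 * ‖x‖ ^ 2 + 4 * ‖y‖ ^ 2 + 6 * ‖u t - u a‖ ^ 2 := norm_add_add_sq_le _ _ _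
    _ ≤ _ := by
      gcongr
      exact hu.norm_sub_sq_le ht

/-- The conclusion is `hright` plus `ε / L` times `henergy`. The parameter `4τL/ε` in `hright` is
chosen so that `hright` and `hW` contribute equally, `4L/ε` each, to the growth rate `8L/ε`. -/
theorem error_recursion_of_estimates {ε L S τ c R R₀ xa xb ga gb A Λ y W Q Q₀ Z : ℝ}
    (hε : 0 < ε) (hL : 0 < L) (hS : 0 ≤ S) (hτ : 0 < τ) (hc : 1 ≤ c) (hR : 0 ≤ R) (hR₀ : 0 ≤ R₀)
    (hxa : 0 ≤ xa) (hga : 0 ≤ ga) (hQ : 0 ≤ Q)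
    (henergy : 3 / 4 * R + (ε / 2 * (gb - ga) + S / ε / 2 * (xb - xa)) ≤
      6 * A + 6 * ε ^ 2 * Λ + 3 / 2 * (L / ε) ^ 2 * W)
    (hW : 3 / 2 * W ≤ τ * (4 * xa + 4 * y + 6 * (τ * Z)))
    (hZ : Z ≤ 2 * (c * (2 * R₀ + 2 * Q₀)) + 2 * Q)
    (hright : xb ≤ (1 + 4 * τ * L / ε) * xa + (1 + 1 / (4 * τ * L / ε)) * (τ * R)) :
    (1 + S / (2 * L)) * xb + ε ^ 2 / (2 * L) * gb + 24 * L * τ * c / ε * τ * R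
        + ε / L * (1 / 4 - 4 * τ ^ 2 * L ^ 2 * (1 + 6 * c) / ε ^ 2) * R ≤
      (1 + 8 * L / ε * τ) * ((1 + S / (2 * L)) * xa + ε ^ 2 / (2 * L) * ga
          + 24 * L * τ * c / ε * τ * R₀)
        + ε / L * (6 * A + 6 * ε ^ 2 * Λ + 4 * L ^ 2 * τ / ε ^ 2 * y
          + 12 * L ^ 2 * τ ^ 2 * c / ε ^ 2 * (Q + 2 * Q₀)) := by
  have nenergy := mul_nonneg (div_pos hε hL).le (sub_nonneg.2 henergy)
  have nright := sub_nonneg.2 hright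
  have nW := mul_nonneg (div_pos hL hε).le (sub_nonneg.2 hW)
  have nZ : 0 ≤ 6 * L * τ ^ 2 / ε * (2 * (c * (2 * R₀ + 2 * Q₀)) + 2 * Q - Z) :=
    mul_nonneg (by positivity) (sub_nonneg.2 hZ)
  have nQ : 0 ≤ 12 * L * τ ^ 2 / ε * ((c - 1) * Q) :=
    mul_nonneg (by positivity) (mul_nonneg (sub_nonneg.2 hc) hQ)
  have nR : 0 ≤ ε / L * ((1 / 4 - τ * L / ε + 4 * (τ * L / ε) ^ 2) * R) :=
    mul_nonneg (by positivity) (mul_nonneg (by nlinarith [sq_nonneg (8 * (τ * L / ε) - 1)]) hR)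
  have nprev : 0 ≤ 8 * L / ε * τ * (S / (2 * L) * xa + ε ^ 2 / (2 * L) * ga
      + 24 * L * τ * c / ε * τ * R₀) := by
    have : 0 ≤ c := zero_le_one.trans hc
    positivity
  rw [← sub_nonneg]
  refine (add_nonneg (add_nonneg (add_nonneg (add_nonneg (add_nonneg (add_nonneg nenergy nright)
    nW) nZ) nQ) nR) nprev).trans_eq ?_
  field_simp
  ring

end Estimates

section Recursion

variable {d : ℕ} {Ω : Set (EuclideanSpace ℝ (Fin d))} {M m k : ℕ} {τ : ℝ} {u u' : ℝ → H01 Ω}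

/-- The energy
`(1 + S/(2L)) ‖ρ^k(t_k)‖² + ε²/(2L) ‖∇ρ^k(t_k)‖² + D_3 τ ‖ρ^k_t‖_k²` of the error at `t_k`, which
the recursion propagates from one time interval to the next. -/
noncomputable def errorEnergy (ε L S : ℝ) (M N : ℕ) (τ : ℝ) (u : ℝ → H01 Ω)
    (h : ℕ → ℝ → H01 Ω) (k : ℕ) : ℝ :=
  (1 + S / (2 * L)) * ‖toL2 (rho M N τ u h k (node τ k))‖ ^ 2
    + ε ^ 2 / (2 * L) * ‖grad (rho M N τ u h k (node τ k))‖ ^ 2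
    + D3 ε L τ N * τ * slabNormSq τ k (fun t => toL2 (deriv (rho M N τ u h k) t))

theorem node_pred_add (τ : ℝ) (hk : 1 ≤ k) : node τ (k - 1) + τ = node τ k := by
  simp only [node, Nat.cast_pred hk]
  ring

theorem node_nonneg (hτ : 0 ≤ τ) (k : ℕ) : 0 ≤ node τ k :=
  mul_nonneg (Nat.cast_nonneg k) hτ

theorem node_mono (hτ : 0 ≤ τ) : Monotone (node τ) := fun _ _ hjk =>
  mul_le_mul_of_nonneg_right (Nat.cast_le.2 hjk) hτ

theorem node_pred_lt (hτ : 0 < τ) (hk : 1 ≤ k) : node τ (k - 1) < node τ k := by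
  rw [← node_pred_add τ hk]
  exact lt_add_of_pos_right _ hτ

theorem slabNormSq_nonneg (hτ : 0 ≤ τ) (k : ℕ) (w : ℝ → L2 Ω) : 0 ≤ slabNormSq τ k w :=
  intervalIntegral.integral_nonneg (node_mono hτ (k.sub_le 1)) fun _ _ => sq_nonneg _

theorem slabNormSq_deriv_eq (hk : node τ (k - 1) ≤ node τ k)
    (hu : C1On (node τ (k - 1)) (node τ k) u u') :
    slabNormSq τ k (fun t => toL2 (deriv u t)) = slabNormSq τ k fun t => toL2 (u' t) :=
  hu.integral_congr hk fun _ x => ‖toL2 x‖ ^ 2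

theorem taylorProj_mem_timePoly (M m : ℕ) (T τ : ℝ) (k : ℕ) (u : ℝ → H01 Ω) :
    taylorProj M (m + 1) T τ k u ∈ timePoly (m + 1) (univ : Set (H01 Ω)) :=
  taylorWithinEval_mem_timePoly (fun s => spaceProj M (u s)) (m + 1) (Icc 0 T) (node τ (k - 1))

theorem slabNormSq_deriv_sub_le (hd : 0 < d) (hΩo : IsOpen Ω) (hΩb : Bornology.IsBounded Ω)
    (hτ : 0 < τ) (hk : 2 ≤ k) (hu : C1On (node τ (k - 1 - 1)) (node τ k) u u') (T : ℝ)
    {h : ℕ → ℝ → H01 Ω} (hprev : h (k - 1) ∈ discreteSpace Ω M (m + 1)) :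
    slabNormSq τ k (fun t => toL2 (deriv (h (k - 1)) t - u' t)) ≤
      2 * (extrapConst m ^ 2 *
          (2 * slabNormSq τ (k - 1) (fun t => toL2 (deriv (rho M (m + 1) τ u h (k - 1)) t))
            + 2 * slabNormSq τ (k - 1) (fun t => toL2 (deriv (fun s =>
                taylorProj M (m + 1) T τ k u s - fullProj M (m + 1) τ (k - 1) u s) t))))
        + 2 * slabNormSq τ k (fun t => toL2 (deriv (taylorErr M (m + 1) T τ k u) t)) := by
  have hlt₁ : node τ (k - 1) < node τ k := node_pred_lt hτ (by omega)
  have hlt₂ : node τ (k - 1 - 1) < node τ (k - 1) := node_pred_lt hτ (by omega)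
  have hend : 2 * node τ (k - 1) - node τ (k - 1 - 1) = node τ k := by
    linarith [node_pred_add τ (show 1 ≤ k by omega), node_pred_add τ (show 1 ≤ k - 1 by omega)]
  have hu₁ : C1On (node τ (k - 1)) (node τ k) u u' := hu.mono hlt₂.le le_rfl
  have hu₂ : C1On (node τ (k - 1 - 1)) (node τ (k - 1)) u u' := hu.mono le_rfl hlt₁.le
  have hT := taylorProj_mem_timePoly M m T τ k u
  have hP := fullProj_mem_discreteSpace hd hΩo hΩb M m hlt₂ hu₂
  have hP₂ := C1On.of_mem_timePoly hP (a := node τ (k - 1 - 1)) (b := node τ (k - 1))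
  have hmap {p : ℝ → H01 Ω} (hp : p ∈ timePoly (m + 1) (univ : Set (H01 Ω))) :
      (fun t => toL2 (deriv p t)) ∈ timePoly m (univ : Set (L2 Ω)) :=
    map_mem_timePoly toL2L.toLinearMap (fun _ _ => mem_univ _) (deriv_mem_timePoly_univ hp)
  have hextrap := integral_norm_sub_sq_extrapolation_le hlt₂
    (hmap (timePoly_mono (subset_univ _) hprev)) (hmap hT)
    (hmap (timePoly_mono (subset_univ _) hP)) (w := fun t => toL2 (u' t))
    (hend ▸ hu₁.toL2.continuousOn_deriv)
  rw [hend] at hextrap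
  simp only [← toL2_sub] at hextrap
  have hρ := slabNormSq_deriv_eq hlt₂.le ((C1On.of_mem_timePoly hprev).sub hP₂)
  have hPT := slabNormSq_deriv_eq hlt₂.le ((C1On.of_mem_timePoly hT).sub hP₂)
  have hTu := slabNormSq_deriv_eq hlt₁.le ((C1On.of_mem_timePoly hT).sub hu₁)
  exact hextrap.trans_eq (congrArg₂ (2 * · + 2 * ·)
    (congrArg₂ (fun x y => extrapConst m ^ 2 * (2 * x + 2 * y)) hρ.symm hPT.symm) hTu.symm)

theorem rho_left_eq (hd : 0 < d) (hΩo : IsOpen Ω) (hΩb : Bornology.IsBounded Ω) (hτ : 0 < τ)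
    (hk : 2 ≤ k) (hu : C1On (node τ (k - 1 - 1)) (node τ k) u u') {h : ℕ → ℝ → H01 Ω}
    (hh : h k (node τ (k - 1)) = h (k - 1) (node τ (k - 1))) :
    rho M (m + 1) τ u h k (node τ (k - 1)) = rho M (m + 1) τ u h (k - 1) (node τ (k - 1)) := by
  have hlt₁ : node τ (k - 1) < node τ k := node_pred_lt hτ (by omega)
  have hlt₂ : node τ (k - 1 - 1) < node τ (k - 1) := node_pred_lt hτ (by omega)
  simp only [rho, hh, fullProj_left hd hΩo hΩb M m hlt₁ (hu.mono hlt₂.le le_rfl),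
    fullProj_right hd hΩo hΩb M m hlt₂ (hu.mono le_rfl hlt₁.le)]

theorem slabNormSq_sub_le (hd : 0 < d) (hΩo : IsOpen Ω) (hΩb : Bornology.IsBounded Ω)
    (hτ : 0 < τ) (hk : 2 ≤ k) (hu : C1On (node τ (k - 1 - 1)) (node τ k) u u')
    {h : ℕ → ℝ → H01 Ω} (hprev : h (k - 1) ∈ discreteSpace Ω M (m + 1))
    (hh : h k (node τ (k - 1)) = h (k - 1) (node τ (k - 1))) :
    3 / 2 * slabNormSq τ k (fun t => toL2 (h (k - 1) t - u t)) ≤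
      τ * (4 * ‖toL2 (rho M (m + 1) τ u h (k - 1) (node τ (k - 1)))‖ ^ 2
        + 4 * ‖toL2 (projErr M (m + 1) τ k u (node τ (k - 1)))‖ ^ 2
        + 6 * (τ * slabNormSq τ k fun t => toL2 (deriv (h (k - 1)) t - u' t))) := by
  have hlt₁ : node τ (k - 1) < node τ k := node_pred_lt hτ (by omega)
  have hlt₂ : node τ (k - 1 - 1) < node τ (k - 1) := node_pred_lt hτ (by omega)
  have hdecomp : toL2 (h (k - 1) (node τ (k - 1)) - u (node τ (k - 1))) =
      toL2 (rho M (m + 1) τ u h (k - 1) (node τ (k - 1)))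
        + toL2 (projErr M (m + 1) τ k u (node τ (k - 1))) := by
    rw [← rho_left_eq hd hΩo hΩb hτ hk hu hh, ← toL2_add, rho, projErr, hh, sub_add_sub_cancel]
  have hdiff := (C1On.of_mem_timePoly hprev).sub (hu.mono hlt₂.le le_rfl)
  have hbound := hdiff.toL2.integral_norm_sq_le hlt₁.le hdecomp
  rwa [← node_pred_add τ (show 1 ≤ k by omega), add_sub_cancel_left,
    node_pred_add τ (show 1 ≤ k by omega)] at hbound

theorem error_recursion (hd : 0 < d) (hΩo : IsOpen Ω) (hΩb : Bornology.IsBounded Ω)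
    (hτ : 0 < τ) (hk : 2 ≤ k) (hu : C1On (node τ (k - 1 - 1)) (node τ k) u u') {f : ℝ → ℝ}
    {ε L S : ℝ} (hε : 0 < ε) (hL : 0 < L) (hS : 0 ≤ S)
    (hf : LipschitzWith L.toNNReal fun y => f y - S * y)
    (hsol : IsWeakSolution f ε (node τ (k - 1)) (node τ k) u) {h : ℕ → ℝ → H01 Ω}
    (hprev : h (k - 1) ∈ discreteSpace Ω M (m + 1))
    (hstep : IsSemiImplicitStep f ε S M (m + 1) (node τ (k - 1)) (node τ k) (h (k - 1)) (h k))
    (T : ℝ) :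
    errorEnergy ε L S M (m + 1) τ u h k + Dtau ε L τ (m + 1) *
        slabNormSq τ k (fun t => toL2 (deriv (rho M (m + 1) τ u h k) t)) ≤
      (1 + D2 ε L * τ) * errorEnergy ε L S M (m + 1) τ u h (k - 1)
        + Ehat ε L S M (m + 1) T τ u k := by
  have hlt₁ : node τ (k - 1) < node τ k := node_pred_lt hτ (by omega)
  have hlt₂ : node τ (k - 1 - 1) < node τ (k - 1) := node_pred_lt hτ (by omega)
  have hu₁ : C1On (node τ (k - 1)) (node τ k) u u' := hu.mono hlt₂.le le_rfl
  have henergy := energy_estimate hd hΩo hΩb hlt₁ hu₁ hε hL.le hf hsol hstep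
    (continuous_of_mem_timePoly hprev) rfl
  have hρ := C1On.of_mem_timePoly (rho_mem_discreteSpace hd hΩo hΩb hlt₁ hu₁ hstep.1)
    (a := node τ (k - 1)) (b := node τ k)
  have hright := hρ.toL2.norm_sq_right_le hlt₁.le (show 0 < 4 * τ * L / ε by positivity)
  rw [sub_eq_of_eq_add' (node_pred_add τ (show 1 ≤ k by omega)).symm] at hright
  rw [rho_left_eq hd hΩo hΩb hτ hk hu hstep.2.1] at henergy hright
  exact error_recursion_of_estimates hε hL hS hτ (one_le_extrapConst_sq m)
    (slabNormSq_nonneg hτ.le _ _) (slabNormSq_nonneg hτ.le _ _) (sq_nonneg _) (sq_nonneg _)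
    (slabNormSq_nonneg hτ.le _ _) henergy (slabNormSq_sub_le hd hΩo hΩb hτ hk hu hprev hstep.2.1)
    (slabNormSq_deriv_sub_le hd hΩo hΩb hτ hk hu T hprev) hright

end Recursion

theorem discrete_gronwall {a : ℝ} (ha : 0 ≤ a) {B r E : ℕ → ℝ} (hB : ∀ k, 0 ≤ B k)
    (hr : ∀ k, 0 ≤ r k) {n : ℕ} (hn : 1 ≤ n)
    (hrec : ∀ k, 2 ≤ k → k ≤ n → B k + r k ≤ (1 + a) * B (k - 1) + E k) :
    B n + ∑ k ∈ Finset.Icc 1 n, r k ≤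
      ∑ k ∈ Finset.Icc 2 n, Real.exp (((n : ℝ) - k) * a) * E k
        + Real.exp (((n : ℝ) - 1) * a) * B 1 + r 1 := by
  induction n, hn using Nat.le_induction with
  | base => simp
  | succ n hn ih =>
    have hprev := mul_le_mul_of_nonneg_left (ih fun k hk hkn => hrec k hk (hkn.trans n.le_succ))
      (Real.exp_pos a).le
    have hlast := hrec (n + 1) (Nat.succ_le_succ hn) le_rfl
    have hgrowth := mul_le_mul_of_nonneg_right (Real.add_one_le_exp a) (hB n)
    have hfirst : r 1 ≤ ∑ k ∈ Finset.Icc 1 n, r k :=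
      Finset.single_le_sum (fun k _ => hr k) (Finset.mem_Icc.2 ⟨le_rfl, hn⟩)
    have hscale := mul_le_mul_of_nonneg_left hfirst (sub_nonneg.2 (Real.one_le_exp ha))
    have hexp (x : ℝ) : Real.exp (((n + 1 : ℕ) - x) * a) =
        Real.exp a * Real.exp ((n - x) * a) := by
      rw [← Real.exp_add]
      congr 1
      push_cast
      ring
    rw [Finset.sum_Icc_succ_top (by omega), Finset.sum_Icc_succ_top (by omega), sub_self,
      zero_mul, Real.exp_zero, one_mul]
    simp only [hexp, mul_assoc, ← Finset.mul_sum]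
    rw [Nat.add_sub_cancel] at hlast
    linarith

section Stability

variable {d : ℕ} {Ω : Set (EuclideanSpace ℝ (Fin d))} {ε L S τ : ℝ}

theorem Dtau_nonneg (hε : 0 < ε) (hL : 0 < L) (hτ : 0 ≤ τ) {N : ℕ}
    (hτle : τ ≤ ε / (4 * L * √(6 * extrapConst (N - 1) ^ 2 + 1))) : 0 ≤ Dtau ε L τ N := by
  have hsqrt : 0 < √(6 * extrapConst (N - 1) ^ 2 + 1) := Real.sqrt_pos.2 (by positivity)
  rw [le_div_iff₀ (by positivity)] at hτle
  have hsq := pow_le_pow_left₀ (by positivity) hτle 2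
  rw [mul_pow, mul_pow, Real.sq_sqrt (by positivity)] at hsq
  refine mul_nonneg (by positivity) (sub_nonneg.2 ?_)
  rw [div_le_iff₀ (by positivity)]
  linarith

theorem errorEnergy_nonneg (hε : 0 ≤ ε) (hL : 0 ≤ L) (hS : 0 ≤ S) (hτ : 0 ≤ τ) (M N : ℕ)
    (u : ℝ → H01 Ω) (h : ℕ → ℝ → H01 Ω) (k : ℕ) : 0 ≤ errorEnergy ε L S M N τ u h k := by
  have hslab := slabNormSq_nonneg hτ k fun t => toL2 (deriv (rho M N τ u h k) t)
  unfold errorEnergy D3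
  positivity

theorem node_div_le {T : ℝ} (hT : 0 ≤ T) {n K : ℕ} (hnK : n ≤ K) : node (T / K) n ≤ T := by
  rw [node, mul_div_left_comm]
  exact mul_le_of_le_one_right hT (div_le_one_of_le₀ (Nat.cast_le.2 hnK) K.cast_nonneg)

end Stability

end ESET

theorem theorem4_general {d : ℕ} (hd : 0 < d)
    (Ω : Set (EuclideanSpace ℝ (Fin d))) (hΩo : IsOpen Ω) (hΩb : Bornology.IsBounded Ω)
    (f : ℝ → ℝ) (ε L S : ℝ) (hε : 0 < ε) (hL : 0 < L) (hS : 0 ≤ S)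
    (hf : LipschitzWith L.toNNReal fun y => f y - S * y)
    (M N : ℕ) (hN : 1 ≤ N) (T τ : ℝ) (hτ : 0 < τ)
    (hτle : τ ≤ ε / (4 * L * √(6 * extrapConst (N - 1) ^ 2 + 1)))
    (u : ℝ → H01 Ω) (hu : ContDiffOn ℝ 1 u (Set.Icc 0 T))
    (h : ℕ → ℝ → H01 Ω) (hfirst : h 1 ∈ discreteSpace Ω M N)
    (n : ℕ) (hn : 1 ≤ n) (hnT : node τ n ≤ T)
    (hsol : ∀ k, 2 ≤ k → k ≤ n → IsWeakSolution f ε (node τ (k - 1)) (node τ k) u)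
    (hscheme : ∀ k, 2 ≤ k → k ≤ n →
      IsSemiImplicitStep f ε S M N (node τ (k - 1)) (node τ k) (h (k - 1)) (h k)) :
    (1 + S / (2 * L)) * ‖toL2 (rho M N τ u h n (node τ n))‖ ^ 2
      + ε ^ 2 / (2 * L) * ‖grad (rho M N τ u h n (node τ n))‖ ^ 2
      + ∑ k ∈ Finset.Icc 1 n,
          Dtau ε L τ N * slabNormSq τ k (fun t => toL2 (deriv (rho M N τ u h k) t))
      + D3 ε L τ N * τ * slabNormSq τ n (fun t => toL2 (deriv (rho M N τ u h n) t))
    ≤ ∑ k ∈ Finset.Icc 2 n,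
          Real.exp (D2 ε L * (((n : ℝ) - k) * τ)) * Ehat ε L S M N T τ u k
      + Real.exp (D2 ε L * (((n : ℝ) - 1) * τ)) *
          ((1 + S / (2 * L)) * ‖toL2 (rho M N τ u h 1 (node τ 1))‖ ^ 2
            + ε ^ 2 / (2 * L) * ‖grad (rho M N τ u h 1 (node τ 1))‖ ^ 2
            + D3 ε L τ N * τ * slabNormSq τ 1 (fun t => toL2 (deriv (rho M N τ u h 1) t)))
      + Dtau ε L τ N * slabNormSq τ 1 (fun t => toL2 (deriv (rho M N τ u h 1) t)) := by
  obtain ⟨m, rfl⟩ := Nat.exists_eq_add_of_le' hN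
  have hT : 0 < T := (node_nonneg hτ.le _).trans_lt ((node_pred_lt hτ hn).trans_le hnT)
  have hmem (k : ℕ) (hk : 1 ≤ k) (hkn : k ≤ n) : h k ∈ discreteSpace Ω M (m + 1) := by
    obtain rfl | hk := hk.eq_or_lt
    exacts [hfirst, (hscheme k hk hkn).1]
  have hrec (k : ℕ) (hk : 2 ≤ k) (hkn : k ≤ n) :=
    error_recursion hd hΩo hΩb hτ hk
      ((C1On.of_contDiffOn hT hu).mono (node_nonneg hτ.le _) ((node_mono hτ.le hkn).trans hnT))
      hε hL hS hf (hsol k hk hkn) (hmem (k - 1) (by omega) (by omega)) (hscheme k hk hkn) T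
  have hgrowth : 0 ≤ D2 ε L * τ := by unfold D2; positivity
  have hbound := discrete_gronwall hgrowth (errorEnergy_nonneg hε.le hL.le hS hτ.le M (m + 1) u h)
    (fun k => mul_nonneg (Dtau_nonneg hε hL hτ.le hτle) (slabNormSq_nonneg hτ.le k _)) hn hrec
  simp only [errorEnergy, mul_left_comm _ (D2 ε L) τ] at hbound
  linarith

theorem theorem4 {d : ℕ} (hd : 0 < d)
    (Ω : Set (EuclideanSpace ℝ (Fin d))) (hΩo : IsOpen Ω) (hΩb : Bornology.IsBounded Ω)
    (f : ℝ → ℝ) (hf : Differentiable ℝ f)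
    (ε L S : ℝ) (hε : 0 < ε) (hL : 0 < L) (hS : 0 ≤ S)
    (hfL : ∀ y, |deriv f y - S| ≤ L)
    (M N : ℕ) (hN : 1 ≤ N)
    (T : ℝ) (hT : 0 < T) (K : ℕ) (hK : 1 ≤ K) (τ : ℝ) (hτ : τ = T / K)
    (hτle : τ ≤ ε / (4 * L * √(6 * extrapConst (N - 1) ^ 2 + 1)))
    (u : ℝ → H01 Ω) (hu : ContDiffOn ℝ (N + 1) u (Set.Icc 0 T))
    (hsol : ∀ n, 1 ≤ n → n ≤ K → IsWeakSolution f ε (node τ (n - 1)) (node τ n) u)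
    (h : ℕ → ℝ → H01 Ω) (hfirst : h 1 ∈ discreteSpace Ω M N)
    (hscheme : ∀ n, 2 ≤ n → n ≤ K →
      IsSemiImplicitStep f ε S M N (node τ (n - 1)) (node τ n) (h (n - 1)) (h n))
    (n : ℕ) (hn : 2 ≤ n) (hnK : n ≤ K) :
    (1 + S / (2 * L)) * ‖toL2 (rho M N τ u h n (node τ n))‖ ^ 2
      + ε ^ 2 / (2 * L) * ‖grad (rho M N τ u h n (node τ n))‖ ^ 2
      + ∑ k ∈ Finset.Icc 1 n,
          Dtau ε L τ N * slabNormSq τ k (fun t => toL2 (deriv (rho M N τ u h k) t))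
      + D3 ε L τ N * τ * slabNormSq τ n (fun t => toL2 (deriv (rho M N τ u h n) t))
    ≤ ∑ k ∈ Finset.Icc 2 n,
          Real.exp (D2 ε L * (((n : ℝ) - k) * τ)) * Ehat ε L S M N T τ u k
      + Real.exp (D2 ε L * (((n : ℝ) - 1) * τ)) *
          ((1 + S / (2 * L)) * ‖toL2 (rho M N τ u h 1 (node τ 1))‖ ^ 2
            + ε ^ 2 / (2 * L) * ‖grad (rho M N τ u h 1 (node τ 1))‖ ^ 2
            + D3 ε L τ N * τ * slabNormSq τ 1 (fun t => toL2 (deriv (rho M N τ u h 1) t)))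
      + Dtau ε L τ N * slabNormSq τ 1 (fun t => toL2 (deriv (rho M N τ u h 1) t)) := by
  subst hτ
  exact theorem4_general hd Ω hΩo hΩb f ε L S hε hL hS (lipschitzWith_sub_mul hf hfL) M N hN T _
    (by positivity) hτle u (hu.of_le le_add_self) h hfirst n (by omega) (node_div_le hT.le hnK)
    (fun k hk hkn => hsol k (by omega) (hkn.trans hnK)) fun k hk hkn => hscheme k hk (hkn.trans hnK)
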